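/- Let $n\in\mathbb N$, $0<\alpha<n$, $1\le p<n/\alpha$ and $\lambda=n-\alpha p$. Let $\mathcal L$ be an operator on $L^2(\mathbb R^n)$ such that $-\mathcal L$ generates a bounded analytic semigroup $e^{-z\mathcal L}$ (strongly continuous, holomorphic and uniformly bounded on a sector $|\arg z|<\theta$), and suppose that for $t>0$ the operator $e^{-t\mathcal L}$ has a kernel $\mathcal P_t(x,y)$, measurable in $(t,x,y)$, with the Gaussian bound $|\mathcal P_t(x,y)|\le C_0t^{-n/2}e^{-A|x-y|^2/t}$ for all $x,y\in\mathbb R^n$, $t>0$, where $C_0,A>0$ are constants. Put $e^{-t\mathcal L}f(x)=\int\mathcal P_t(x,y)f(y)\,dy$ and $$\mathcal L^{-\alpha/2}f(x)=\frac1{\Gamma(\alpha/2)}\int_0^\infty e^{-t\mathcal L}f(x)\,t^{\alpha/2-1}dt,$$ $$(I-e^{-t\mathcal L})\mathcal L^{-\alpha/2}f(x)=\frac1{\Gamma(\alpha/2)}\int_0^\infty\big(e^{-r\mathcal L}f(x)-e^{-(r+t)\mathcal L}f(x)\big)r^{\alpha/2-1}dr .$$ A locally integrable $f:\mathbb R^n\to\mathbb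 C$ belongs to $M^{p,\lambda}(\mathbb R^n)$ if $\|f\|_{M^{p,\lambda}}=\sup_B m(B)^{-\lambda/(pn)}\big(\int_B|f|^p\big)^{1/p}<\infty$, the supremum being over all balls $B$. For $\varepsilon>0$ let $\mathcal M=\mathcal M^{(\varepsilon)}$ be the set of locally integrable $g$ with $\int|g(x)|^2(1+|x|)^{-n-\varrho}dx<\infty$ for some $0<\varrho<\varepsilon$. A function $g\in\mathcal M$ belongs to $\mathrm{BMO}_{\mathcal L}(\mathbb R^n)$ if $$\|g\|_{\mathrm{BMO}_{\mathcal L}}=\Big\|\,x\mapsto\sup_{B\ni x}\frac1{m(B)}\int_B|g(y)-e^{-r_B^2\mathcal L}g(y)|\,dy\Big\|_{L^\infty}<\infty ,$$ where $r_B$ is the radius of the ball $B$. Then there is a constant $C>0$ such that for every $f\in M^{p,\lambda}(\mathbb R^n)$ the following hold. (1) For all $t>0$, the integral $e^{-t\mathcal L}f(x)$ converges absolutely for every $x$, the integral defining $(I-e^{-t\mathcal L})\mathcal L^{-\alpha/2}f(x)$ converges absolutely for almost every $x$, and for every ball $B$ $$\frac1{m(B)}\int_B\big|(I-e^{-r_B^2\mathcal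 L})\mathcal L^{-\alpha/2}f(x)\big|\,dx\le C\|f\|_{M^{p,\lambda}} .$$ (2) Let $\varepsilon>0$ and suppose that the integral defining $\mathcal L^{-\alpha/2}f(x)$ converges absolutely for almost every $x$ and that $x\mapsto\int_0^\infty|e^{-t\mathcal L}f(x)|\,t^{\alpha/2-1}dt$ belongs to $\mathcal M$. Then $\mathcal L^{-\alpha/2}f-e^{-t\mathcal L}(\mathcal L^{-\alpha/2}f)=(I-e^{-t\mathcal L})\mathcal L^{-\alpha/2}f$ almost everywhere for every $t>0$, the function $\mathcal L^{-\alpha/2}f$ belongs to $\mathrm{BMO}_{\mathcal L}(\mathbb R^n)$, and $$\|\mathcal L^{-\alpha/2}f\|_{\mathrm{BMO}_{\mathcal L}}\le C\|f\|_{M^{p,\lambda}} .$$ (3) If $\int|f(y)|\,|x-y|^{\alpha-n}dy<\infty$ for almost every $x$, then the assumption of (2) holds for every $\varepsilon>0$. -/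

import Mathlib

open MeasureTheory Filter Topology
open scoped ENNReal NNReal

noncomputable section

/-- The Euclidean space `ℝⁿ` with the Euclidean norm and Lebesgue measure `volume`. -/
abbrev RSpace (n : ℕ) : Type := EuclideanSpace ℝ (Fin n)

/-- The Hilbert space `L²(ℝⁿ)` of complex-valued functions. -/
abbrev L2Space (n : ℕ) : Type := Lp ℂ 2 (volume : Measure (RSpace n))

/-! ### The semigroup -/

/-- The open sector `{z ≠ 0 : |arg z| < θ}`. -/
def openSector (θ : ℝ) : Set ℂ := {z | z ≠ 0 ∧ |z.arg| < θ}

/-- `S` is a bounded analytic semigroup on `L²(ℝⁿ)`, i.e. a strongly continuous semigroup with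
a bounded holomorphic extension to some sector; `S z` plays the role of `e^{-zL}`. -/
def IsBoundedAnalyticSemigroup {n : ℕ} (S : ℂ → L2Space n →L[ℂ] L2Space n) : Prop :=
  ∃ θ : ℝ, 0 < θ ∧ θ ≤ Real.pi / 2 ∧
    (∀ z ∈ openSector θ, ∀ w ∈ openSector θ, S (z + w) = (S z).comp (S w)) ∧
    DifferentiableOn ℂ S (openSector θ) ∧
    (∃ M : ℝ, ∀ z ∈ openSector θ, ‖S z‖ ≤ M) ∧
    ∀ u : L2Space n, Tendsto (fun t : ℝ => S (t : ℂ) u) (𝓝[>] 0) (𝓝 u)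

/-- The (in general unbounded) operator `L` is the one whose semigroup is `e^{-tL} = S t`:
`L u = lim_{t → 0+} (u - S t u) / t`, with domain the set of all `u` for which the limit exists. -/
def IsSemigroupGenerator {n : ℕ} (L : L2Space n →ₗ.[ℂ] L2Space n)
    (S : ℂ → L2Space n →L[ℂ] L2Space n) : Prop :=
  ∀ u v : L2Space n, (u, v) ∈ L.graph ↔
    Tendsto (fun t : ℝ => ((t : ℂ)⁻¹) • (u - S (t : ℂ) u)) (𝓝[>] 0) (𝓝 v)

/-- `P t x y` is a measurable kernel of `S t`, for every `t > 0`. -/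
def IsHeatKernel {n : ℕ} (S : ℂ → L2Space n →L[ℂ] L2Space n)
    (P : ℝ → RSpace n → RSpace n → ℂ) : Prop :=
  (Measurable fun q : ℝ × RSpace n × RSpace n => P q.1 q.2.1 q.2.2) ∧
    ∀ t : ℝ, 0 < t → ∀ u : L2Space n, ∀ᵐ x : RSpace n,
      (S (t : ℂ) u : RSpace n → ℂ) x = ∫ y, P t x y * (u : RSpace n → ℂ) y

/-- The Gaussian upper bound `|P_t(x,y)| ≤ C t^{-n/2} exp(-A |x-y|² / t)`. -/
def GaussianBound {n : ℕ} (P : ℝ → RSpace n → RSpace n → ℂ) : Prop :=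
  ∃ C A : ℝ, 0 < C ∧ 0 < A ∧ ∀ t : ℝ, 0 < t → ∀ x y : RSpace n,
    ‖P t x y‖ ≤ C / t ^ ((n : ℝ) / 2) * Real.exp (-(A * ‖x - y‖ ^ 2 / t))

/-- `e^{-tL} f (x) = ∫ P_t(x,y) f(y) dy`, the action of the semigroup on functions through its
kernel. -/
def heat {n : ℕ} (P : ℝ → RSpace n → RSpace n → ℂ) (t : ℝ) (f : RSpace n → ℂ)
    (x : RSpace n) : ℂ :=
  ∫ y, P t x y * f y

/-! ### The generalized fractional integral -/

/-- `L^{-α/2} f (x) = Γ(α/2)⁻¹ ∫₀^∞ e^{-tL} f (x) t^{α/2-1} dt`. -/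
def fracInt {n : ℕ} (P : ℝ → RSpace n → RSpace n → ℂ) (α : ℝ) (f : RSpace n → ℂ)
    (x : RSpace n) : ℂ :=
  (Real.Gamma (α / 2))⁻¹ • ∫ t in Set.Ioi (0 : ℝ), t ^ (α / 2 - 1) • heat P t f x

/-- The difference operator
`(I - e^{-tL}) L^{-α/2} f (x) = Γ(α/2)⁻¹ ∫₀^∞ (e^{-rL} f (x) - e^{-(r+t)L} f (x)) r^{α/2-1} dr`. -/
def fracDiff {n : ℕ} (P : ℝ → RSpace n → RSpace n → ℂ) (α t : ℝ) (f : RSpace n → ℂ)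
    (x : RSpace n) : ℂ :=
  (Real.Gamma (α / 2))⁻¹ •
    ∫ r in Set.Ioi (0 : ℝ), r ^ (α / 2 - 1) • (heat P r f x - heat P (r + t) f x)

/-- The Riesz potential of `|f|`, up to its normalizing constant. -/
def rieszAbs {n : ℕ} (α : ℝ) (f : RSpace n → ℂ) (x : RSpace n) : ℝ≥0∞ :=
  ∫⁻ y, ‖f y‖ₑ * ENNReal.ofReal (‖x - y‖ ^ (α - n))

/-! ### Function spaces -/

/-- The Morrey norm `sup_B m(B)^{-λ/(pn)} (∫_B |f|^p)^{1/p}`. -/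
def morreyNorm {n : ℕ} (p lam : ℝ) (f : RSpace n → ℂ) : ℝ≥0∞ :=
  ⨆ (c : RSpace n) (r : ℝ) (_ : 0 < r),
    eLpNorm f (ENNReal.ofReal p) (volume.restrict (Metric.ball c r)) /
      volume (Metric.ball c r) ^ (lam / (p * n))

/-- Membership in the Morrey space `M^{p,λ}(ℝⁿ)`. -/
def MemMorrey {n : ℕ} (p lam : ℝ) (f : RSpace n → ℂ) : Prop :=
  LocallyIntegrable f ∧ morreyNorm p lam f < ∞

/-- Functions of `ρ`-type: `f` is locally integrable and `∫ |f(x)|² (1+|x|)^{-n-ρ} dx < ∞`. -/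
def MemType {n : ℕ} {F : Type*} [NormedAddCommGroup F] (ρ : ℝ) (f : RSpace n → F) : Prop :=
  LocallyIntegrable f ∧
    Integrable fun x : RSpace n => ‖f x‖ ^ 2 / (1 + ‖x‖) ^ ((n : ℝ) + ρ)

/-- The union of the spaces of functions of `ρ`-type over `0 < ρ < ε`. -/
def MemScriptM {n : ℕ} {F : Type*} [NormedAddCommGroup F] (ε : ℝ) (f : RSpace n → F) : Prop :=
  ∃ ρ : ℝ, 0 < ρ ∧ ρ < ε ∧ MemType ρ f

/-- The sharp maximal function
`sup_{B ∋ x} m(B)⁻¹ ∫_B |g(y) - e^{-t_B L} g(y)| dy`, where `t_B` is the squared radius of `B`. -/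
def sharpMaximal {n : ℕ} (P : ℝ → RSpace n → RSpace n → ℂ) (g : RSpace n → ℂ)
    (x : RSpace n) : ℝ≥0∞ :=
  ⨆ (c : RSpace n) (r : ℝ) (_ : 0 < r) (_ : x ∈ Metric.ball c r),
    ⨍⁻ y in Metric.ball c r, ‖g y - heat P (r ^ 2) g y‖ₑ ∂volume

/-- The (semi-)norm of `BMO_L(ℝⁿ)`, the `L^∞` norm of the sharp maximal function. -/
def bmoNorm {n : ℕ} (P : ℝ → RSpace n → RSpace n → ℂ) (g : RSpace n → ℂ) : ℝ≥0∞ :=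
  essSup (sharpMaximal P g) volume

/-- Membership in `BMO_L(ℝⁿ)`. -/
def MemBMO {n : ℕ} (ε : ℝ) (P : ℝ → RSpace n → RSpace n → ℂ) (g : RSpace n → ℂ) : Prop :=
  MemScriptM ε g ∧ bmoNorm P g < ∞

/-- The integral defining `L^{-α/2} f` converges absolutely almost everywhere, and the integral of
the absolute values belongs to the space of functions on which `BMO_L` is defined. -/
def FracIntConverges {n : ℕ} (ε : ℝ) (P : ℝ → RSpace n → RSpace n → ℂ) (α : ℝ)
    (f : RSpace n → ℂ) : Prop :=
  (∀ᵐ x : RSpace n,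
      IntegrableOn (fun t : ℝ => t ^ (α / 2 - 1) • heat P t f x) (Set.Ioi 0)) ∧
    MemScriptM ε fun x : RSpace n =>
      ∫ t in Set.Ioi (0 : ℝ), ‖t ^ (α / 2 - 1) • heat P t f x‖

end

/-! By Hölder, a Morrey function satisfies `∫_B |f| ≤ K r^(n-α)` on every ball of radius `r`, with
`K` a multiple of its norm (`exists_ballGrowth_of_morreyNorm`). Only this growth is used afterwards,
so `p` disappears and `p = 1` needs no separate treatment. For a Gaussian convolution of `|f|` at
time `t` the growth gives two bounds: it is pointwise at most a multiple of `K t^(-α/2)`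
(`exists_gaussConv_le`), and its integral over a ball of radius `R` is at most a multiple of `K
R^(n-α)`, uniformly in `t` (`setLIntegral_gaussConv_le`).

The cancellation in `e^{-sL} - e^{-(s+t)L}` comes from analyticity. Cauchy's estimate bounds its
`L²` operator norm by a multiple of `t/s`. Placing this difference between two copies of
`e^{-(s/3)L}`, one mapping `L¹` to `L²` and one mapping `L²` to `L^∞`, bounds the kernel by a
multiple of `(t/s) s^(-n/2)`. The geometric mean with the Gaussian bound then leaves a Gaussian with
the gain `√(t/s)` for `t ≤ s` (`exists_ae_norm_kernel_sub_le_gaussKernel`).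

In the difference operator, times `s > t` therefore contribute at most a multiple of `K ∫_t^∞ √t
s^(-3/2) ds = 2K`. For `s ≤ t` no cancellation is needed: the two terms are estimated separately,
the one at time `s` after integration over the ball. With `t = r²` everything scales like `r^n`,
which is the oscillation estimate (`exists_setLAverage_fracDiff_le`).

For the BMO bound, Fubini and the semigroup law on Morrey functions (`ae_heat_heat`) identify `g -
e^{-tL} g`, for `g = L^{-α/2} f`, with the difference operator (`ae_fracInt_sub_heat_fracInt`).

For the last claim, the potential is split at time `R²` on the ball of radius `R`. The early part
has square integral of order `R^n`; the late part is bounded by the Riesz potential at one fixed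
point where it is finite. Growth of order `R^n` is integrable against `(1+|x|)^(-n-ρ)` for every `ρ
> 0`. -/

theorem lintegral_Ioc_zero_rpow {s a : ℝ} (hs : -1 < s) (ha : 0 < a) :
    ∫⁻ t in Set.Ioc 0 a, ENNReal.ofReal (t ^ s) = ENNReal.ofReal (a ^ (s + 1) / (s + 1)) := by
  have hi : IntegrableOn (fun t : ℝ => t ^ s) (Set.Ioc 0 a) :=
    (intervalIntegrable_iff_integrableOn_Ioc_of_le ha.le).1
      (intervalIntegral.intervalIntegrable_rpow' hs)
  rw [← ofReal_integral_eq_lintegral_ofReal hi, ← intervalIntegral.integral_of_le ha.le,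
    integral_rpow (Or.inl hs), Real.zero_rpow (by linarith), sub_zero]
  exact (ae_restrict_mem measurableSet_Ioc).mono fun t ht => Real.rpow_nonneg ht.1.le _

theorem lintegral_Ioi_rpow {s a : ℝ} (hs : s < -1) (ha : 0 < a) :
    ∫⁻ t in Set.Ioi a, ENNReal.ofReal (t ^ s) = ENNReal.ofReal (a ^ (s + 1) / -(s + 1)) := by
  rw [← ofReal_integral_eq_lintegral_ofReal (integrableOn_Ioi_rpow_of_lt hs ha),
    integral_Ioi_rpow_of_lt hs ha, neg_div, div_neg]
  exact (ae_restrict_mem measurableSet_Ioi).mono fun t ht => Real.rpow_nonneg (ha.trans ht).le _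

/-! ### Gaussian convolutions of functions with Morrey growth. -/

/-- The Gaussian `t^{-n/2} exp(-b |x|² / t)`. -/
noncomputable def gaussKernel {n : ℕ} (b t : ℝ) (x : RSpace n) : ℝ :=
  Real.exp (-(b * ‖x‖ ^ 2 / t)) / t ^ ((n : ℝ) / 2)

/-- The convolution of a nonnegative function with a Gaussian. -/
noncomputable def gaussConv {n : ℕ} (b t : ℝ) (h : RSpace n → ℝ≥0∞) (x : RSpace n) : ℝ≥0∞ :=
  ∫⁻ y, ENNReal.ofReal (gaussKernel b t (x - y)) * h y

/-- The Morrey type growth condition `∫_{B(c,r)} h ≤ K r^β`. -/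
def BallGrowth {n : ℕ} (β : ℝ) (K : ℝ≥0∞) (h : RSpace n → ℝ≥0∞) : Prop :=
  ∀ (c : RSpace n) (r : ℝ), 0 < r →
    ∫⁻ y in Metric.ball c r, h y ≤ K * ENNReal.ofReal (r ^ β)

section Gauss

variable {n : ℕ}

theorem gaussKernel_nonneg (b : ℝ) {t : ℝ} (ht : 0 < t) (x : RSpace n) :
    0 ≤ gaussKernel b t x := by
  unfold gaussKernel; positivity

@[fun_prop]
theorem Measurable.gaussKernel {X : Type*} [MeasurableSpace X] {t : X → ℝ} {g : X → RSpace n}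
    (b : ℝ) (ht : Measurable t) (hg : Measurable g) :
    Measurable fun q => _root_.gaussKernel b (t q) (g q) := by
  unfold _root_.gaussKernel; fun_prop

theorem measurable_gaussConv_uncurry (b : ℝ) {h : RSpace n → ℝ≥0∞} (hh : Measurable h) :
    Measurable fun q : ℝ × RSpace n => gaussConv b q.1 h q.2 := by
  unfold gaussConv
  refine Measurable.lintegral_prod_right'
    (f := fun z : (ℝ × RSpace n) × RSpace n =>
      ENNReal.ofReal (gaussKernel b z.1.1 (z.1.2 - z.2)) * h z.2) ?_
  fun_prop

@[fun_prop]
theorem Measurable.gaussConv {X : Type*} [MeasurableSpace X] {t : X → ℝ} {g : X → RSpace n}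
    (b : ℝ) {h : RSpace n → ℝ≥0∞} (hh : Measurable h) (ht : Measurable t) (hg : Measurable g) :
    Measurable fun q => _root_.gaussConv b (t q) h (g q) := by
  have := (measurable_gaussConv_uncurry b hh).comp (ht.prodMk hg)
  exact this

theorem integrable_exp_neg_mul_sq_norm {b : ℝ} (hb : 0 < b) :
    Integrable fun x : RSpace n => Real.exp (-b * ‖x‖ ^ 2) := by
  by_contra h
  have h1 := GaussianFourier.integral_rexp_neg_mul_sq_norm (V := RSpace n) hb
  rw [integral_undef h] at h1
  have : 0 < (Real.pi / b) ^ (Module.finrank ℝ (RSpace n) / 2 : ℝ) := by positivity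
  linarith

theorem lintegral_gaussKernel {b t : ℝ} (hb : 0 < b) (ht : 0 < t) :
    ∫⁻ x : RSpace n, ENNReal.ofReal (gaussKernel b t x)
      = ENNReal.ofReal ((Real.pi / b) ^ ((n : ℝ) / 2)) := by
  have e : (fun x : RSpace n => gaussKernel b t x)
      = fun x => Real.exp (-(b / t) * ‖x‖ ^ 2) / t ^ ((n : ℝ) / 2) := by
    funext x; unfold gaussKernel; congr 2; ring
  rw [← ofReal_integral_eq_lintegral_ofReal _ (ae_of_all _ fun x => gaussKernel_nonneg b ht x), e,
    integral_div, GaussianFourier.integral_rexp_neg_mul_sq_norm (by positivity),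
    finrank_euclideanSpace, Fintype.card_fin, ← Real.div_rpow (by positivity) ht.le]
  · congr 2; field_simp
  · change Integrable fun x : RSpace n => gaussKernel b t x
    rw [e]; exact (integrable_exp_neg_mul_sq_norm (by positivity)).div_const _

/-- The convolution is a superposition of translates of `h`, all with the same growth constant, and
the weights have total mass `(π/b)^(n/2)` whatever `t` is. -/
theorem setLIntegral_gaussConv_le {β : ℝ} {K : ℝ≥0∞} {h : RSpace n → ℝ≥0∞} (hh : Measurable h)
    (hK : BallGrowth β K h) {b t : ℝ} (hb : 0 < b) (ht : 0 < t) (c : RSpace n) {R : ℝ}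
    (hR : 0 < R) :
    ∫⁻ x in Metric.ball c R, gaussConv b t h x
      ≤ ENNReal.ofReal ((Real.pi / b) ^ ((n : ℝ) / 2)) * (K * ENNReal.ofReal (R ^ β)) := by
  have e : ∀ x : RSpace n,
      gaussConv b t h x = ∫⁻ y, ENNReal.ofReal (gaussKernel b t y) * h (x - y) := by
    intro x
    rw [← lintegral_sub_left_eq_self _ x]
    simp [gaussConv]
  simp_rw [e]
  rw [lintegral_lintegral_swap (by fun_prop), ← lintegral_gaussKernel hb ht,
    ← lintegral_mul_const _ (by fun_prop)]
  refine lintegral_mono fun y => ?_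
  rw [lintegral_const_mul _ (by fun_prop)]
  gcongr
  refine le_trans (le_of_eq ?_) (hK (c - y) R hR)
  rw [← lintegral_indicator measurableSet_ball, ← lintegral_indicator measurableSet_ball]
  conv_rhs => rw [← lintegral_sub_right_eq_self _ y]
  refine lintegral_congr fun x => ?_
  have : x - y ∈ Metric.ball (c - y) R ↔ x ∈ Metric.ball c R := by
    simp [Metric.mem_ball, dist_eq_norm]
  by_cases hx : x ∈ Metric.ball c R
  · rw [Set.indicator_of_mem hx, Set.indicator_of_mem (this.2 hx)]
  · rw [Set.indicator_of_notMem hx, Set.indicator_of_notMem (this.not.2 hx)]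

/-- Since `|z-y|² ≤ 2|x-z|² + 2|x-y|²`, moving the centre by `O(√t)` costs a constant factor once
the exponent `b` is halved. This serves as a Harnack-type comparison. -/
theorem gaussKernel_le_of_norm_sub_le {b t M : ℝ} (hb : 0 < b) (ht : 0 < t) {x z : RSpace n}
    (hxz : ‖x - z‖ ≤ M * √t) (y : RSpace n) :
    gaussKernel b t (x - y) ≤ Real.exp (b * M ^ 2) * gaussKernel (b / 2) t (z - y) := by
  unfold gaussKernel
  rw [← mul_div_assoc, ← Real.exp_add]
  gcongr
  have h1 : ‖z - y‖ ≤ ‖x - z‖ + ‖x - y‖ := by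
    have : z - y = (x - y) - (x - z) := by abel
    rw [this, add_comm]; exact norm_sub_le _ _
  have h2 : ‖z - y‖ ^ 2 ≤ 2 * (M * √t) ^ 2 + 2 * ‖x - y‖ ^ 2 := by
    have h3 : ‖z - y‖ ^ 2 ≤ (M * √t + ‖x - y‖) ^ 2 := by
      gcongr; linarith
    nlinarith [sq_nonneg (M * √t - ‖x - y‖)]
  rw [mul_pow, Real.sq_sqrt ht.le] at h2
  have h4 : b / 2 * ‖z - y‖ ^ 2 / t ≤ b / 2 * (2 * (M ^ 2 * t) + 2 * ‖x - y‖ ^ 2) / t := by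
    gcongr
  have h5 : b / 2 * (2 * (M ^ 2 * t) + 2 * ‖x - y‖ ^ 2) / t
      = b * M ^ 2 + b * ‖x - y‖ ^ 2 / t := by field_simp
  linarith

theorem gaussConv_le_of_norm_sub_le {b t M : ℝ} (hb : 0 < b) (ht : 0 < t) {x z : RSpace n}
    (hxz : ‖x - z‖ ≤ M * √t) {h : RSpace n → ℝ≥0∞} (hh : Measurable h) :
    gaussConv b t h x ≤ ENNReal.ofReal (Real.exp (b * M ^ 2)) * gaussConv (b / 2) t h z := by
  unfold gaussConv
  rw [← lintegral_const_mul _ (by fun_prop)]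
  refine lintegral_mono fun y => ?_
  rw [← mul_assoc, ← ENNReal.ofReal_mul (by positivity)]
  gcongr
  exact gaussKernel_le_of_norm_sub_le hb ht hxz y

theorem volume_ball_eq (x : RSpace n) {r : ℝ} (hr : 0 < r) :
    volume (Metric.ball x r) = ENNReal.ofReal (r ^ (n : ℝ)) * volume (Metric.ball (0 : RSpace n) 1) := by
  rw [Measure.addHaar_ball_of_pos _ _ hr, finrank_euclideanSpace, Fintype.card_fin,
    Real.rpow_natCast]

/-- The value at `x` is comparable to values throughout the ball of radius `√t` about `x`; averaging
over that ball turns the integrated bound into a pointwise one. -/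
theorem exists_gaussConv_le (n : ℕ) (α : ℝ) {b : ℝ} (hb : 0 < b) :
    ∃ C : ℝ≥0, ∀ (K : ℝ≥0∞) (h : RSpace n → ℝ≥0∞), Measurable h → BallGrowth (n - α) K h →
      ∀ t : ℝ, 0 < t → ∀ x, gaussConv b t h x ≤ C * K * ENNReal.ofReal (t ^ (-(α / 2))) := by
  set ω := volume (Metric.ball (0 : RSpace n) 1) with hω
  have hω0 : ω ≠ 0 := (Metric.measure_ball_pos _ _ one_pos).ne'
  have hωt : ω ≠ ∞ := measure_ball_lt_top.ne
  set c1 := ENNReal.ofReal (Real.exp (b * 1 ^ 2)) with hc1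
  set c2 := ENNReal.ofReal ((Real.pi / (b / 2)) ^ ((n : ℝ) / 2)) with hc2
  have hC : c1 * c2 / ω ≠ ∞ :=
    ENNReal.div_ne_top (ENNReal.mul_ne_top ENNReal.ofReal_ne_top ENNReal.ofReal_ne_top) hω0
  refine ⟨(c1 * c2 / ω).toNNReal, fun K h hh hK t ht x => ?_⟩
  rw [ENNReal.coe_toNNReal hC]
  have hst : 0 < √t := Real.sqrt_pos.2 ht
  have key : gaussConv b t h x * volume (Metric.ball x √t)
      ≤ c1 * (c2 * (K * ENNReal.ofReal (√t ^ ((n : ℝ) - α)))) := by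
    rw [← setLIntegral_const]
    calc ∫⁻ _ in Metric.ball x √t, gaussConv b t h x
        ≤ ∫⁻ z in Metric.ball x √t, c1 * gaussConv (b / 2) t h z := by
          refine setLIntegral_mono (by fun_prop) fun z hz => ?_
          refine gaussConv_le_of_norm_sub_le hb ht ?_ hh
          rw [one_mul, ← dist_eq_norm, dist_comm]
          exact (Metric.mem_ball.1 hz).le
      _ = c1 * ∫⁻ z in Metric.ball x √t, gaussConv (b / 2) t h z :=
          lintegral_const_mul _ (by fun_prop)
      _ ≤ _ := by
          gcongr
          exact setLIntegral_gaussConv_le hh hK (by positivity) ht x hst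
  rw [volume_ball_eq x hst, ← hω] at key
  have hp : ENNReal.ofReal (√t ^ ((n : ℝ) - α))
      = ENNReal.ofReal (√t ^ (n : ℝ)) * ENNReal.ofReal (t ^ (-(α / 2))) := by
    rw [← ENNReal.ofReal_mul (by positivity), Real.sqrt_eq_rpow, ← Real.rpow_mul ht.le,
      ← Real.rpow_mul ht.le, ← Real.rpow_add ht]
    congr 2; ring
  have h0 : ENNReal.ofReal (√t ^ (n : ℝ)) ≠ 0 := by
    rw [Ne, ENNReal.ofReal_eq_zero, not_le]; positivity
  rw [hp] at key
  have key2 : gaussConv b t h x * (ENNReal.ofReal (√t ^ (n : ℝ)) * ω)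
      ≤ (c1 * c2 / ω * K * ENNReal.ofReal (t ^ (-(α / 2))))
        * (ENNReal.ofReal (√t ^ (n : ℝ)) * ω) := by
    refine key.trans (le_of_eq ?_)
    calc _ = (c1 * c2) * K * ENNReal.ofReal (t ^ (-(α / 2))) * ENNReal.ofReal (√t ^ (n : ℝ)) := by
          ring
      _ = (c1 * c2 / ω * ω) * K * ENNReal.ofReal (t ^ (-(α / 2)))
          * ENNReal.ofReal (√t ^ (n : ℝ)) := by rw [ENNReal.div_mul_cancel hω0 hωt]
      _ = _ := by ring
  exact (ENNReal.mul_le_mul_iff_left (mul_ne_zero h0 hω0)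
    (ENNReal.mul_ne_top ENNReal.ofReal_ne_top hωt)).1 key2

theorem Real.exp_neg_le_rpow_neg {β v : ℝ} (hβ : 0 < β) (hv : 0 < v) :
    Real.exp (-v) ≤ β ^ β * v ^ (-β) := by
  have h1 : v / β ≤ Real.exp (v / β) := by linarith [Real.add_one_le_exp (v / β)]
  have h2 : (v / β) ^ β ≤ Real.exp v := by
    calc (v / β) ^ β ≤ Real.exp (v / β) ^ β := by gcongr
      _ = Real.exp v := by rw [← Real.exp_mul]; congr 1; field_simp
  rw [Real.div_rpow hv.le hβ.le, div_le_iff₀ (by positivity)] at h2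
  rw [Real.rpow_neg hv.le, Real.exp_neg, ← div_eq_mul_inv, le_div_iff₀ (by positivity),
    inv_mul_le_iff₀ (by positivity)]
  exact h2

/-- The time integral is split at `t = |x|²`: below it the exponential absorbs the singularity at `t
= 0`, above it the exponential is bounded by 1 and the power decays. -/
theorem exists_lintegral_rpow_mul_gaussKernel_le {α : ℝ} (hαn : α < n) {b : ℝ} (hb : 0 < b) :
    ∃ C : ℝ≥0, ∀ x : RSpace n, x ≠ 0 →
      ∫⁻ t in Set.Ioi (0 : ℝ), ENNReal.ofReal (t ^ (α / 2 - 1)) *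
        ENNReal.ofReal (gaussKernel b t x) ≤ C * ENNReal.ofReal (‖x‖ ^ (α - n)) := by
  set β : ℝ := n - α with hβ
  have hβ0 : 0 < β := by linarith
  set c : ℝ := β ^ β * b ^ (-β) with hc
  have hc0 : 0 ≤ c := by positivity
  refine ⟨(c * (2 / β) + 2 / β).toNNReal, fun x hx => ?_⟩
  have hd : 0 < ‖x‖ := norm_pos_iff.2 hx
  set d := ‖x‖ with hdd
  have hd2 : 0 < d ^ 2 := by positivity
  rw [← Set.Ioc_union_Ioi_eq_Ioi hd2.le,
    lintegral_union measurableSet_Ioi (Set.Ioc_disjoint_Ioi le_rfl)]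
  have e1 : ∫⁻ t in Set.Ioc 0 (d ^ 2), ENNReal.ofReal (t ^ (α / 2 - 1)) *
      ENNReal.ofReal (gaussKernel b t x) ≤ ENNReal.ofReal (c * (2 / β) * d ^ (α - n)) := by
    calc _ ≤ ∫⁻ t in Set.Ioc 0 (d ^ 2),
            ENNReal.ofReal (c * d ^ (-(2 * β))) * ENNReal.ofReal (t ^ (β / 2 - 1)) := by
          refine setLIntegral_mono (by fun_prop) fun t ht => ?_
          have ht0 : 0 < t := ht.1
          rw [← ENNReal.ofReal_mul (by positivity), ← ENNReal.ofReal_mul (by positivity)]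
          apply ENNReal.ofReal_le_ofReal
          -- The exponent `β = n - α` in `Real.exp_neg_le_rpow_neg` turns `t^(α/2-1) t^(-n/2)` into
          -- `t^(β/2-1)`, which is integrable at 0.
          have hv : Real.exp (-(b * d ^ 2 / t)) ≤ c * d ^ (-(2 * β)) * t ^ β := by
            refine (Real.exp_neg_le_rpow_neg hβ0 (by positivity)).trans (le_of_eq ?_)
            rw [mul_div_assoc, Real.mul_rpow hb.le (by positivity),
              Real.div_rpow hd2.le ht0.le, Real.rpow_neg ht0.le β, ← Real.rpow_natCast d 2,
              ← Real.rpow_mul hd.le, hc, div_inv_eq_mul]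
            rw [show ((2 : ℕ) : ℝ) * -β = -(2 * β) by push_cast; ring]
            ring
          have e : t ^ (β / 2 - 1) = t ^ (α / 2 - 1) * (t ^ β / t ^ ((n : ℝ) / 2)) := by
            rw [← Real.rpow_sub ht0, ← Real.rpow_add ht0]; congr 1; rw [hβ]; ring
          unfold gaussKernel
          rw [e]
          calc t ^ (α / 2 - 1) * (Real.exp (-(b * ‖x‖ ^ 2 / t)) / t ^ ((n : ℝ) / 2))
              ≤ t ^ (α / 2 - 1) * ((c * d ^ (-(2 * β)) * t ^ β) / t ^ ((n : ℝ) / 2)) := by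
                gcongr
            _ = _ := by ring
      _ = ENNReal.ofReal (c * (2 / β) * d ^ (α - n)) := by
          rw [lintegral_const_mul _ (by fun_prop), lintegral_Ioc_zero_rpow (by linarith) hd2,
            ← ENNReal.ofReal_mul (by positivity)]
          congr 1
          rw [sub_add_cancel, ← Real.rpow_natCast d 2, ← Real.rpow_mul hd.le]
          have : d ^ (α - n) = d ^ (-(2 * β)) * d ^ (((2 : ℕ) : ℝ) * (β / 2)) := by
            rw [← Real.rpow_add hd]; congr 1; rw [hβ]; push_cast; ring
          rw [this]; field_simp
  have e2 : ∫⁻ t in Set.Ioi (d ^ 2), ENNReal.ofReal (t ^ (α / 2 - 1)) *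
      ENNReal.ofReal (gaussKernel b t x) ≤ ENNReal.ofReal ((2 / β) * d ^ (α - n)) := by
    calc _ ≤ ∫⁻ t in Set.Ioi (d ^ 2), ENNReal.ofReal (t ^ (-(β / 2) - 1)) := by
          refine setLIntegral_mono (by fun_prop) fun t ht => ?_
          have ht0 : 0 < t := hd2.trans ht
          rw [← ENNReal.ofReal_mul (by positivity)]
          apply ENNReal.ofReal_le_ofReal
          have e : t ^ (-(β / 2) - 1) = t ^ (α / 2 - 1) * (1 / t ^ ((n : ℝ) / 2)) := by
            rw [one_div, ← Real.rpow_neg ht0.le, ← Real.rpow_add ht0]; congr 1; rw [hβ]; ring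
          unfold gaussKernel
          rw [e]
          gcongr
          exact Real.exp_le_one_iff.2 (by simp only [Left.neg_nonpos_iff]; positivity)
      _ = ENNReal.ofReal ((2 / β) * d ^ (α - n)) := by
          rw [lintegral_Ioi_rpow (by linarith) hd2]
          congr 1
          rw [sub_add_cancel, ← Real.rpow_natCast d 2, ← Real.rpow_mul hd.le,
            show ((2 : ℕ) : ℝ) * -(β / 2) = α - n by rw [hβ]; push_cast; ring]
          field_simp
  refine (add_le_add e1 e2).trans (le_of_eq ?_)
  rw [← ENNReal.ofReal_add (by positivity) (by positivity), ← add_mul,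
    ENNReal.ofReal_mul (by positivity)]
  rfl

theorem exists_lintegral_rpow_mul_gaussConv_le {α : ℝ} (hα : 0 < α) (hαn : α < n) {b : ℝ}
    (hb : 0 < b) :
    ∃ C : ℝ≥0, ∀ h : RSpace n → ℝ≥0∞, Measurable h → ∀ x : RSpace n,
      ∫⁻ t in Set.Ioi (0 : ℝ), ENNReal.ofReal (t ^ (α / 2 - 1)) * gaussConv b t h x
        ≤ C * ∫⁻ y, h y * ENNReal.ofReal (‖x - y‖ ^ (α - n)) := by
  obtain ⟨C, hC⟩ := exists_lintegral_rpow_mul_gaussKernel_le hαn hb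
  refine ⟨C, fun h hh x => ?_⟩
  have hn : 0 < n := by exact_mod_cast hα.trans hαn
  have : NeZero n := ⟨hn.ne'⟩
  unfold gaussConv
  simp_rw [← lintegral_const_mul' _ _ ENNReal.ofReal_ne_top]
  rw [lintegral_lintegral_swap (by fun_prop), ← lintegral_const_mul _ (by fun_prop)]
  refine lintegral_mono_ae ?_
  -- The diagonal must be discarded: there `‖x - y‖ ^ (α - n)` takes the value 0 instead of `∞`.
  -- Points are null because the dimension is positive.
  have : ∀ᵐ y : RSpace n, y ≠ x := by
    simp [ae_iff, measure_singleton]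
  filter_upwards [this] with y hy
  simp_rw [← mul_assoc]
  rw [lintegral_mul_const _ (by fun_prop)]
  refine (mul_le_mul_left (hC (x - y) (sub_ne_zero.2 hy.symm)) _).trans (le_of_eq ?_)
  ring

end Gauss

/-! ### Quadratic growth of potentials and integrability against polynomial weights. -/

/-- The square is a double integral over `(s, t)`, and by symmetry the triangle `s ≤ t` carries at
least half of it. Ordering the two times lets one factor take the pointwise bound and the other the
integrated bound. -/
theorem sq_setLIntegral_Ioc_le {a : ℝ} {G : ℝ → ℝ≥0∞} (hG : Measurable G) :
    (∫⁻ t in Set.Ioc 0 a, G t) ^ 2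
      ≤ 2 * ∫⁻ t in Set.Ioc 0 a, G t * ∫⁻ s in Set.Ioc 0 t, G s := by
  have hsplit : ∀ t ∈ Set.Ioc 0 a, ∫⁻ s in Set.Ioc 0 a, G s
      = (∫⁻ s in Set.Ioc 0 t, G s) + ∫⁻ s in Set.Ioc t a, G s := fun t ht => by
    rw [← lintegral_union measurableSet_Ioc (Set.Ioc_disjoint_Ioc_of_le le_rfl),
      Set.Ioc_union_Ioc_eq_Ioc ht.1.le ht.2]
  have hm1 : Measurable fun q : ℝ × ℝ => (Set.Ioc 0 q.1).indicator G q.2 := by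
    have : (fun q : ℝ × ℝ => (Set.Ioc 0 q.1).indicator G q.2)
        = {q : ℝ × ℝ | 0 < q.2 ∧ q.2 ≤ q.1}.indicator fun q => G q.2 := by
      funext q; simp [Set.indicator, Set.mem_Ioc]
    rw [this]
    refine (hG.comp measurable_snd).indicator ?_
    exact (measurableSet_lt measurable_const measurable_snd).inter
      (measurableSet_le measurable_snd measurable_fst)
  have hm1' : Measurable fun t => ∫⁻ s in Set.Ioc 0 t, G s := by
    simp_rw [← lintegral_indicator measurableSet_Ioc]
    exact hm1.lintegral_prod_right'
  have hsw : ∫⁻ t in Set.Ioc 0 a, G t * ∫⁻ s in Set.Ioc t a, G s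
      ≤ ∫⁻ t in Set.Ioc 0 a, G t * ∫⁻ s in Set.Ioc 0 t, G s := by
    have hm2 : Measurable fun q : ℝ × ℝ =>
        {q : ℝ × ℝ | q.1 < q.2}.indicator (fun q => G q.1 * G q.2) q :=
      ((hG.comp measurable_fst).mul (hG.comp measurable_snd)).indicator
        (measurableSet_lt measurable_fst measurable_snd)
    calc _ = ∫⁻ t in Set.Ioc 0 a, ∫⁻ s in Set.Ioc 0 a,
            {q : ℝ × ℝ | q.1 < q.2}.indicator (fun q => G q.1 * G q.2) (t, s) := by
          refine setLIntegral_congr_fun measurableSet_Ioc fun t ht => ?_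
          rw [← lintegral_const_mul _ hG, ← lintegral_indicator measurableSet_Ioc,
            ← lintegral_indicator measurableSet_Ioc]
          refine lintegral_congr fun s => ?_
          by_cases h1 : t < s <;> by_cases h2 : s ≤ a <;>
            simp [Set.indicator, h1, h2, ht.1.trans, Set.mem_Ioc]
      _ = ∫⁻ s in Set.Ioc 0 a, ∫⁻ t in Set.Ioc 0 a,
            {q : ℝ × ℝ | q.1 < q.2}.indicator (fun q => G q.1 * G q.2) (t, s) :=
          lintegral_lintegral_swap hm2.aemeasurable
      _ ≤ _ := by
          refine lintegral_mono fun s => ?_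
          rw [← lintegral_const_mul _ hG, ← lintegral_indicator measurableSet_Ioc,
            ← lintegral_indicator measurableSet_Ioc]
          refine lintegral_mono fun t => ?_
          by_cases h1 : t < s <;> by_cases h2 : 0 < t <;>
            simp [Set.indicator, h1, h2, Set.mem_Ioc, mul_comm]
          · rw [if_pos h1.le]
            split_ifs <;> simp
  calc _ = ∫⁻ t in Set.Ioc 0 a, G t * ∫⁻ s in Set.Ioc 0 a, G s := by
        rw [lintegral_mul_const _ hG, sq]
    _ = ∫⁻ t in Set.Ioc 0 a, (G t * (∫⁻ s in Set.Ioc 0 t, G s)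
          + G t * ∫⁻ s in Set.Ioc t a, G s) := by
        refine setLIntegral_congr_fun measurableSet_Ioc fun t ht => ?_
        rw [hsplit t ht, mul_add]
    _ = (∫⁻ t in Set.Ioc 0 a, G t * ∫⁻ s in Set.Ioc 0 t, G s)
          + ∫⁻ t in Set.Ioc 0 a, G t * ∫⁻ s in Set.Ioc t a, G s :=
        lintegral_add_left (hG.mul hm1') _
    _ ≤ _ := by rw [two_mul]; gcongr

section Growth

variable {n : ℕ}

theorem setLIntegral_rpow_mul_gaussConv_le {α : ℝ} (hα : 0 < α) {K : ℝ≥0∞} {h : RSpace n → ℝ≥0∞}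
    (hh : Measurable h) (hK : BallGrowth (n - α) K h) {b a : ℝ} (hb : 0 < b) (ha : 0 < a)
    (c : RSpace n) {R : ℝ} (hR : 0 < R) :
    ∫⁻ x in Metric.ball c R, ∫⁻ t in Set.Ioc 0 a,
        ENNReal.ofReal (t ^ (α / 2 - 1)) * gaussConv b t h x
      ≤ ENNReal.ofReal ((Real.pi / b) ^ ((n : ℝ) / 2)) * (K * ENNReal.ofReal (R ^ ((n : ℝ) - α)))
        * ENNReal.ofReal (2 / α * a ^ (α / 2)) := by
  rw [lintegral_lintegral_swap (by fun_prop)]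
  calc _ ≤ ∫⁻ t in Set.Ioc 0 a, ENNReal.ofReal (t ^ (α / 2 - 1)) *
          (ENNReal.ofReal ((Real.pi / b) ^ ((n : ℝ) / 2))
            * (K * ENNReal.ofReal (R ^ ((n : ℝ) - α)))) := by
        refine setLIntegral_mono (by fun_prop) fun t ht => ?_
        rw [lintegral_const_mul _ (by fun_prop)]
        gcongr
        exact setLIntegral_gaussConv_le hh hK hb ht.1 c hR
    _ = _ := by
        rw [lintegral_mul_const _ (by fun_prop), lintegral_Ioc_zero_rpow (by linarith) ha,
          mul_comm]
        congr 2
        rw [sub_add_cancel]; field_simp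

/-- After the times are ordered `s ≤ t`, the factor at `t` is at most `C K / t` pointwise, and the
integral over `s ≤ t`, integrated over the ball, is of order `K R^(n-α) t^(α/2)`. The remaining
integral of `t^(α/2-1)` over `(0, R²]` supplies `R^α`. -/
theorem exists_setLIntegral_sq_le (n : ℕ) {α : ℝ} (hα : 0 < α) {b : ℝ} (hb : 0 < b) :
    ∃ C : ℝ≥0, ∀ (K : ℝ≥0∞) (h : RSpace n → ℝ≥0∞), Measurable h → BallGrowth (n - α) K h →
      ∀ (c : RSpace n) (R : ℝ), 0 < R →
      ∫⁻ x in Metric.ball c R, (∫⁻ t in Set.Ioc 0 (R ^ 2),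
        ENNReal.ofReal (t ^ (α / 2 - 1)) * gaussConv b t h x) ^ 2
        ≤ C * K ^ 2 * ENNReal.ofReal (R ^ (n : ℝ)) := by
  obtain ⟨C, hC⟩ := exists_gaussConv_le n α hb
  set c1 := (Real.pi / b) ^ ((n : ℝ) / 2) with hc1
  have hc1' : 0 ≤ c1 := by positivity
  refine ⟨2 * C * (c1 * (2 / α) * (2 / α)).toNNReal, fun K h hh hK c R hR => ?_⟩
  have hR2 : 0 < R ^ 2 := by positivity
  set G : ℝ → RSpace n → ℝ≥0∞ := fun t x =>
    ENNReal.ofReal (t ^ (α / 2 - 1)) * gaussConv b t h x with hGdef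
  have hGm : Measurable fun q : ℝ × RSpace n => G q.1 q.2 := by
    simp only [hGdef]; fun_prop
  have hGmt : ∀ x, Measurable fun t => G t x := fun x => by
    simp only [hGdef]; fun_prop
  have hQm : Measurable fun q : RSpace n × ℝ => ∫⁻ s in Set.Ioc 0 q.2, G s q.1 := by
    simp_rw [← lintegral_indicator measurableSet_Ioc]
    refine Measurable.lintegral_prod_right'
      (f := fun z : (RSpace n × ℝ) × ℝ => (Set.Ioc 0 z.1.2).indicator (fun s => G s z.1.1) z.2) ?_
    have : (fun z : (RSpace n × ℝ) × ℝ => (Set.Ioc 0 z.1.2).indicator (fun s => G s z.1.1) z.2)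
        = {z : (RSpace n × ℝ) × ℝ | 0 < z.2 ∧ z.2 ≤ z.1.2}.indicator fun z => G z.2 z.1.1 := by
      funext q; simp [Set.indicator, Set.mem_Ioc]
    rw [this]
    refine Measurable.indicator ?_ ?_
    · exact hGm.comp (measurable_snd.prodMk (measurable_fst.comp measurable_fst))
    · exact (measurableSet_lt measurable_const measurable_snd).inter
        (measurableSet_le measurable_snd (measurable_snd.comp measurable_fst))
  have hcoef : ∀ t : ℝ, 0 < t → ∀ x, G t x ≤ C * K * ENNReal.ofReal (t⁻¹) := fun t ht x => by
    calc G t x ≤ ENNReal.ofReal (t ^ (α / 2 - 1)) * (C * K * ENNReal.ofReal (t ^ (-(α / 2)))) := by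
          simp only [hGdef]; gcongr; exact hC K h hh hK t ht x
      _ = C * K * ENNReal.ofReal (t⁻¹) := by
          rw [mul_left_comm, ← ENNReal.ofReal_mul (by positivity), ← Real.rpow_add ht,
            ← Real.rpow_neg_one]
          congr 3; ring
  calc _ ≤ ∫⁻ x in Metric.ball c R,
          2 * ∫⁻ t in Set.Ioc 0 (R ^ 2), G t x * ∫⁻ s in Set.Ioc 0 t, G s x :=
        lintegral_mono fun x => sq_setLIntegral_Ioc_le (hGmt x)
    _ ≤ ∫⁻ x in Metric.ball c R,
          2 * ∫⁻ t in Set.Ioc 0 (R ^ 2),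
            C * K * ENNReal.ofReal (t⁻¹) * ∫⁻ s in Set.Ioc 0 t, G s x := by
        refine lintegral_mono fun x => ?_
        gcongr 2 * ?_
        refine setLIntegral_mono' measurableSet_Ioc fun t ht => ?_
        gcongr
        exact hcoef t ht.1 x
    _ = 2 * ∫⁻ t in Set.Ioc 0 (R ^ 2), C * K * ENNReal.ofReal (t⁻¹) *
          ∫⁻ x in Metric.ball c R, ∫⁻ s in Set.Ioc 0 t, G s x := by
        rw [lintegral_const_mul' _ _ (by norm_num), lintegral_lintegral_swap]
        · congr 1
          refine lintegral_congr fun t => ?_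
          have hQt : Measurable fun x => ∫⁻ s in Set.Ioc 0 t, G s x :=
            hQm.comp (measurable_id.prodMk measurable_const)
          rw [lintegral_const_mul _ hQt]
        · refine Measurable.aemeasurable (Measurable.mul ?_ hQm)
          fun_prop
    _ ≤ 2 * ∫⁻ t in Set.Ioc 0 (R ^ 2), C * K * ENNReal.ofReal (t⁻¹) *
          (ENNReal.ofReal c1 * (K * ENNReal.ofReal (R ^ ((n : ℝ) - α)))
            * ENNReal.ofReal (2 / α * t ^ (α / 2))) := by
        gcongr 2 * ?_
        refine setLIntegral_mono' measurableSet_Ioc fun t ht => ?_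
        gcongr
        exact setLIntegral_rpow_mul_gaussConv_le hα hh hK hb ht.1 c hR
    _ = 2 * ∫⁻ t in Set.Ioc 0 (R ^ 2), C * K * (ENNReal.ofReal c1 *
          (K * ENNReal.ofReal (R ^ ((n : ℝ) - α)))) * ENNReal.ofReal (2 / α) *
            ENNReal.ofReal (t ^ (α / 2 - 1)) := by
        congr 1
        refine setLIntegral_congr_fun measurableSet_Ioc fun t ht => ?_
        have ht0 : 0 < t := ht.1
        have e : ENNReal.ofReal (t ^ (α / 2 - 1))
            = ENNReal.ofReal t⁻¹ * ENNReal.ofReal (t ^ (α / 2)) := by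
          rw [← ENNReal.ofReal_mul (by positivity), Real.rpow_sub_one ht0.ne', div_eq_inv_mul]
        rw [e, ENNReal.ofReal_mul (by positivity)]
        ring
    _ = 2 * C * K ^ 2 * (ENNReal.ofReal c1 * ENNReal.ofReal (2 / α) *
          ENNReal.ofReal (R ^ ((n : ℝ) - α)) * ENNReal.ofReal ((R ^ 2) ^ (α / 2) / (α / 2))) := by
        rw [lintegral_const_mul _ (by fun_prop), lintegral_Ioc_zero_rpow (by linarith) hR2,
          sub_add_cancel]
        ring
    _ = _ := by
        have e0 : ∀ a b : ℝ≥0∞, 2 * C * b * K ^ 2 * a = 2 * C * K ^ 2 * (b * a) := fun a b => by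
          ring
        push_cast
        rw [e0]
        congr 1
        change _ = ENNReal.ofReal _ * _
        rw [← ENNReal.ofReal_mul (by positivity), ← ENNReal.ofReal_mul (by positivity),
          ← ENNReal.ofReal_mul (by positivity), ← ENNReal.ofReal_mul (by positivity)]
        congr 1
        have e1 : (R ^ 2) ^ (α / 2) = R ^ α := by
          rw [← Real.rpow_natCast, ← Real.rpow_mul hR.le]; congr 1; push_cast; ring
        have e2 : R ^ (n : ℝ) = R ^ ((n : ℝ) - α) * R ^ α := by
          rw [← Real.rpow_add hR, sub_add_cancel]
        rw [e1, e2]; field_simp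

/-- The weight is written as a superposition of indicators of balls (layer cake), which reduces the
claim to the convergence of `∫_1^∞ t^(-ρ-1) dt`. -/
theorem lintegral_mul_one_add_norm_rpow_lt_top {H : RSpace n → ℝ≥0∞} (hH : Measurable H)
    {Q : ℝ≥0∞} (hQ : Q ≠ ∞) {R₀ : ℝ} (hR₀ : 1 ≤ R₀)
    (hHQ : ∀ R : ℝ, R₀ ≤ R → ∫⁻ x in Metric.ball (0 : RSpace n) R, H x
      ≤ Q * ENNReal.ofReal (R ^ (n : ℝ))) {ρ : ℝ} (hρ : 0 < ρ) :
    ∫⁻ x, H x * ENNReal.ofReal ((1 + ‖x‖) ^ (-((n : ℝ) + ρ))) < ∞ := by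
  set m : ℝ := n + ρ with hm
  have hm0 : 0 < m := by positivity
  have hpow : ∀ x : RSpace n, ENNReal.ofReal ((1 + ‖x‖) ^ (-m))
      = ∫⁻ t in Set.Ioi (1 : ℝ), ENNReal.ofReal m *
        {q : ℝ × RSpace n | 1 + ‖q.2‖ < q.1}.indicator
          (fun q => ENNReal.ofReal (q.1 ^ (-m - 1))) (t, x) := by
    intro x
    have hx : 0 < 1 + ‖x‖ := by positivity
    rw [lintegral_const_mul']
    swap
    · exact ENNReal.ofReal_ne_top
    have e : ∫⁻ t in Set.Ioi (1 : ℝ), {q : ℝ × RSpace n | 1 + ‖q.2‖ < q.1}.indicator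
          (fun q => ENNReal.ofReal (q.1 ^ (-m - 1))) (t, x)
        = ∫⁻ t in Set.Ioi (1 + ‖x‖), ENNReal.ofReal (t ^ (-m - 1)) := by
      rw [← lintegral_indicator measurableSet_Ioi, ← lintegral_indicator measurableSet_Ioi]
      refine lintegral_congr fun t => ?_
      by_cases h1 : 1 + ‖x‖ < t
      · have : 1 < t := by linarith [norm_nonneg x]
        simp [Set.indicator, h1, this]
      · simp [Set.indicator, h1]
    rw [e, lintegral_Ioi_rpow (by linarith) hx, ← ENNReal.ofReal_mul hm0.le]
    congr 1
    rw [sub_add_cancel, neg_neg]; field_simp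
  have hmeas : Measurable fun q : ℝ × RSpace n => ENNReal.ofReal m *
        {q : ℝ × RSpace n | 1 + ‖q.2‖ < q.1}.indicator
          (fun q => ENNReal.ofReal (q.1 ^ (-m - 1))) q := by
    refine Measurable.const_mul (Measurable.indicator (by fun_prop) ?_) _
    exact measurableSet_lt (by fun_prop) (by fun_prop)
  calc _ = ∫⁻ x, ∫⁻ t in Set.Ioi (1 : ℝ), H x * (ENNReal.ofReal m *
        {q : ℝ × RSpace n | 1 + ‖q.2‖ < q.1}.indicator
          (fun q => ENNReal.ofReal (q.1 ^ (-m - 1))) (t, x)) := by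
        refine lintegral_congr fun x => ?_
        have hmt : Measurable fun t : ℝ => ENNReal.ofReal m *
            {q : ℝ × RSpace n | 1 + ‖q.2‖ < q.1}.indicator
              (fun q => ENNReal.ofReal (q.1 ^ (-m - 1))) (t, x) :=
          hmeas.comp (measurable_id.prodMk measurable_const)
        rw [hpow, lintegral_const_mul _ hmt]
    _ = ∫⁻ t in Set.Ioi (1 : ℝ), ∫⁻ x, H x * (ENNReal.ofReal m *
        {q : ℝ × RSpace n | 1 + ‖q.2‖ < q.1}.indicator
          (fun q => ENNReal.ofReal (q.1 ^ (-m - 1))) (t, x)) := by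
        refine lintegral_lintegral_swap (Measurable.aemeasurable ?_)
        exact (hH.comp measurable_fst).mul (hmeas.comp measurable_swap)
    _ ≤ ∫⁻ t in Set.Ioi (1 : ℝ), ENNReal.ofReal m * Q * ENNReal.ofReal (R₀ ^ (n : ℝ)) *
          ENNReal.ofReal (t ^ (-ρ - 1)) := by
        refine setLIntegral_mono' measurableSet_Ioi fun t ht => ?_
        have ht1 : (1 : ℝ) < t := ht
        have ht0 : 0 < t := by linarith
        -- The ball of radius `t - 1` is enlarged to radius `R₀ t`, since the growth hypothesis is
        -- available only from `R₀` on.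
        calc _ ≤ ∫⁻ x, ENNReal.ofReal m * ENNReal.ofReal (t ^ (-m - 1)) *
                (Metric.ball (0 : RSpace n) (R₀ * t)).indicator H x := by
              refine lintegral_mono fun x => ?_
              by_cases h1 : 1 + ‖x‖ < t
              · have : x ∈ Metric.ball (0 : RSpace n) (R₀ * t) := by
                  rw [mem_ball_zero_iff]; nlinarith
                rw [Set.indicator_of_mem this]
                simp only [Set.indicator, Set.mem_ofPred_eq, h1, if_true]
                exact le_of_eq (by ring)
              · simp [Set.indicator, h1]
          _ = ENNReal.ofReal m * ENNReal.ofReal (t ^ (-m - 1)) *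
                ∫⁻ x in Metric.ball (0 : RSpace n) (R₀ * t), H x := by
              rw [lintegral_const_mul' _ _ (ENNReal.mul_ne_top ENNReal.ofReal_ne_top
                ENNReal.ofReal_ne_top), lintegral_indicator measurableSet_ball]
          _ ≤ ENNReal.ofReal m * ENNReal.ofReal (t ^ (-m - 1)) *
                (Q * ENNReal.ofReal ((R₀ * t) ^ (n : ℝ))) := by
              gcongr
              exact hHQ _ (by nlinarith)
          _ = _ := by
              rw [Real.mul_rpow (by positivity) ht0.le, ENNReal.ofReal_mul (by positivity)]
              have e : ENNReal.ofReal (t ^ (-ρ - 1))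
                  = ENNReal.ofReal (t ^ (-m - 1)) * ENNReal.ofReal (t ^ (n : ℝ)) := by
                rw [← ENNReal.ofReal_mul (by positivity), ← Real.rpow_add ht0]
                congr 2; rw [hm]; ring
              rw [e]; ring
    _ < ∞ := by
        rw [lintegral_const_mul _ (by fun_prop), lintegral_Ioi_rpow (by linarith) one_pos]
        exact ENNReal.mul_lt_top (ENNReal.mul_lt_top (ENNReal.mul_lt_top ENNReal.ofReal_lt_top
          hQ.lt_top) ENNReal.ofReal_lt_top) ENNReal.ofReal_lt_top

/-- Quadratic growth of the Riesz potential of a Morrey function that is finite at one point. -/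
theorem exists_setLIntegral_sq_rieszPotential_le {α : ℝ} (hα : 0 < α) (hαn : α < n) {b : ℝ}
    (hb : 0 < b) {K : ℝ≥0∞} (hKt : K ≠ ∞) {h : RSpace n → ℝ≥0∞} (hh : Measurable h)
    (hK : BallGrowth (n - α) K h) {x₀ : RSpace n}
    (hx₀ : ∫⁻ y, h y * ENNReal.ofReal (‖x₀ - y‖ ^ (α - n)) ≠ ∞) :
    ∃ Q : ℝ≥0∞, Q ≠ ∞ ∧ ∀ R : ℝ, 1 + ‖x₀‖ ≤ R →
      ∫⁻ x in Metric.ball (0 : RSpace n) R, (∫⁻ t in Set.Ioi (0 : ℝ),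
        ENNReal.ofReal (t ^ (α / 2 - 1)) * gaussConv b t h x) ^ 2
        ≤ Q * ENNReal.ofReal (R ^ (n : ℝ)) := by
  obtain ⟨C, hC⟩ := exists_setLIntegral_sq_le n hα hb
  obtain ⟨D, hD⟩ := exists_lintegral_rpow_mul_gaussConv_le hα hαn (half_pos hb)
  set J := ∫⁻ y, h y * ENNReal.ofReal (‖x₀ - y‖ ^ (α - n)) with hJ
  set E := ENNReal.ofReal (Real.exp (b * 2 ^ 2)) * (D * J) with hE
  have hEt : E ≠ ∞ := ENNReal.mul_ne_top ENNReal.ofReal_ne_top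
    (ENNReal.mul_ne_top ENNReal.coe_ne_top hx₀)
  set ω := volume (Metric.ball (0 : RSpace n) 1) with hω
  have hωt : ω ≠ ∞ := measure_ball_lt_top.ne
  refine ⟨2 * (C * K ^ 2) + 2 * (E ^ 2 * ω), ?_, fun R hR => ?_⟩
  · refine ENNReal.add_ne_top.2 ⟨ENNReal.mul_ne_top (by norm_num) (ENNReal.mul_ne_top
      ENNReal.coe_ne_top (ENNReal.pow_ne_top hKt)), ENNReal.mul_ne_top (by norm_num)
      (ENNReal.mul_ne_top (ENNReal.pow_ne_top hEt) hωt)⟩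
  have hR0 : 0 < R := by linarith [norm_nonneg x₀]
  have hR2 : 0 < R ^ 2 := by positivity
  -- For `t > R²` one has `|x - x₀| ≤ 2R ≤ 2√t`, so `x` can be replaced by `x₀`; this is the source
  -- of `exp(b 2²)` and of the halved exponent in `D`.
  have hfar : ∀ x ∈ Metric.ball (0 : RSpace n) R, ∫⁻ t in Set.Ioi (R ^ 2),
      ENNReal.ofReal (t ^ (α / 2 - 1)) * gaussConv b t h x ≤ E := by
    intro x hx
    rw [mem_ball_zero_iff] at hx
    calc _ ≤ ∫⁻ t in Set.Ioi (R ^ 2), ENNReal.ofReal (Real.exp (b * 2 ^ 2)) *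
            (ENNReal.ofReal (t ^ (α / 2 - 1)) * gaussConv (b / 2) t h x₀) := by
          refine setLIntegral_mono' measurableSet_Ioi fun t ht => ?_
          have ht0 : 0 < t := hR2.trans ht
          rw [mul_left_comm]
          gcongr
          refine gaussConv_le_of_norm_sub_le hb ht0 ?_ hh
          have h1 : R ≤ √t := Real.le_sqrt_of_sq_le (Set.mem_Ioi.1 ht).le
          linarith [norm_sub_le x x₀]
      _ = ENNReal.ofReal (Real.exp (b * 2 ^ 2)) * ∫⁻ t in Set.Ioi (R ^ 2),
            (ENNReal.ofReal (t ^ (α / 2 - 1)) * gaussConv (b / 2) t h x₀) :=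
          lintegral_const_mul _ (by fun_prop)
      _ ≤ E := by
          rw [hE]
          gcongr
          refine le_trans ?_ (hD h hh x₀)
          exact lintegral_mono_set (Set.Ioi_subset_Ioi hR2.le)
  calc _ ≤ ∫⁻ x in Metric.ball (0 : RSpace n) R, (2 * (∫⁻ t in Set.Ioc 0 (R ^ 2),
        ENNReal.ofReal (t ^ (α / 2 - 1)) * gaussConv b t h x) ^ 2 + 2 * E ^ 2) := by
        refine setLIntegral_mono' measurableSet_ball fun x hx => ?_
        rw [← Set.Ioc_union_Ioi_eq_Ioi hR2.le,
          lintegral_union measurableSet_Ioi (Set.Ioc_disjoint_Ioi le_rfl)]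
        refine (pow_le_pow_left' (add_le_add_right (hfar x hx) _) 2).trans ?_
        have h1 := fun a b : ℝ≥0∞ => ENNReal.rpow_add_le_mul_rpow_add_rpow a b one_le_two
        simp only [ENNReal.rpow_two, show (2 : ℝ) - 1 = 1 by norm_num, ENNReal.rpow_one,
          mul_add] at h1
        exact h1 _ _
    _ = 2 * (∫⁻ x in Metric.ball (0 : RSpace n) R, (∫⁻ t in Set.Ioc 0 (R ^ 2),
        ENNReal.ofReal (t ^ (α / 2 - 1)) * gaussConv b t h x) ^ 2)
          + 2 * E ^ 2 * volume (Metric.ball (0 : RSpace n) R) := by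
        rw [lintegral_add_right _ measurable_const, lintegral_const_mul' _ _ (by norm_num),
          setLIntegral_const]
    _ ≤ 2 * (C * K ^ 2 * ENNReal.ofReal (R ^ (n : ℝ)))
          + 2 * E ^ 2 * (ENNReal.ofReal (R ^ (n : ℝ)) * ω) := by
        rw [volume_ball_eq 0 hR0]
        gcongr
        exact hC K h hh hK 0 R hR0
    _ = _ := by ring

end Growth

/-! ### The analytic semigroup on `L²` and auxiliary facts about `L²`. -/

theorem ofReal_mem_openSector {θ s : ℝ} (hθ : 0 < θ) (hs : 0 < s) : (s : ℂ) ∈ openSector θ := by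
  refine ⟨by exact_mod_cast hs.ne', ?_⟩
  rw [Complex.arg_ofReal_of_nonneg hs.le, abs_zero]; exact hθ

/-- The sector is invariant under positive dilations, so a disc around 1 scales to a disc around `s`
of radius proportional to `s`. This gives Cauchy's estimate the decay `1/s`. -/
theorem exists_ball_subset_openSector {θ : ℝ} (hθ : 0 < θ) :
    ∃ κ : ℝ, 0 < κ ∧ ∀ s : ℝ, 0 < s → Metric.ball (s : ℂ) (s * κ) ⊆ openSector θ := by
  have h1 : ∀ᶠ z : ℂ in 𝓝 1, z ∈ openSector θ := by
    have ha : Tendsto Complex.arg (𝓝 1) (𝓝 0) := by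
      have := Complex.continuousAt_arg Complex.one_mem_slitPlane
      rwa [ContinuousAt, Complex.arg_one] at this
    have h2 : ∀ᶠ z : ℂ in 𝓝 1, |z.arg| < θ := by
      have := ha.abs
      rw [abs_zero] at this
      exact this.eventually_lt_const hθ
    filter_upwards [h2, isOpen_ne.mem_nhds (one_ne_zero (α := ℂ))] with z hz hz0
    exact ⟨hz0, hz⟩
  obtain ⟨κ, hκ, hball⟩ := Metric.eventually_nhds_iff_ball.1 h1
  refine ⟨κ, hκ, fun s hs z hz => ?_⟩
  have hsc : (s : ℂ) ≠ 0 := by exact_mod_cast hs.ne'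
  have hw : z / s ∈ Metric.ball (1 : ℂ) κ := by
    rw [mem_ball_iff_norm] at hz ⊢
    rw [div_sub_one hsc, norm_div, Complex.norm_real, Real.norm_of_nonneg hs.le,
      div_lt_iff₀ hs, mul_comm]
    exact hz
  obtain ⟨h0, harg⟩ := hball _ hw
  have hz' : z = (s : ℂ) * (z / s) := by field_simp
  refine ⟨fun h => h0 (by rw [h, zero_div]), ?_⟩
  rw [hz', Complex.arg_real_mul _ hs]; exact harg

section Semigroup

variable {n : ℕ}

/-- Cauchy's estimate for the derivative of a bounded analytic semigroup. -/
theorem IsBoundedAnalyticSemigroup.exists_norm_sub_le {S : ℂ → L2Space n →L[ℂ] L2Space n}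
    (hS : IsBoundedAnalyticSemigroup S) :
    ∃ C : ℝ, 0 ≤ C ∧ ∀ s t : ℝ, 0 < s → 0 < t →
      ‖S (s : ℂ) - S ((s + t : ℝ) : ℂ)‖ ≤ C * (t / s) := by
  obtain ⟨θ, hθ, -, -, hd, ⟨M, hM⟩, -⟩ := hS
  obtain ⟨κ, hκ, hball⟩ := exists_ball_subset_openSector hθ
  have hM0 : 0 ≤ M := (norm_nonneg _).trans (hM _ (ofReal_mem_openSector hθ one_pos))
  have hderiv : ∀ σ : ℝ, 0 < σ → ‖deriv S (σ : ℂ)‖ ≤ M / (σ * κ / 2) := fun σ hσ => by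
    -- Half the radius is taken so that the closed disc, including its boundary circle, lies in the
    -- sector.
    have hsub : Metric.closedBall (σ : ℂ) (σ * κ / 2) ⊆ openSector θ :=
      (Metric.closedBall_subset_ball (by nlinarith [mul_pos hσ hκ])).trans (hball σ hσ)
    refine Complex.norm_deriv_le_of_forall_mem_sphere_norm_le (by positivity)
      (hd.diffContOnCl_ball hsub) fun z hz => hM z (hsub (Metric.sphere_subset_closedBall hz))
  refine ⟨2 * M / κ, by positivity, fun s t hs ht => ?_⟩
  have hpath : ∀ σ ∈ Set.Icc s (s + t), HasDerivWithinAt (fun σ : ℝ => S (σ : ℂ))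
      (deriv S (σ : ℂ)) (Set.Icc s (s + t)) σ := fun σ hσ => by
    have hσ0 : 0 < σ := hs.trans_le hσ.1
    have hdiff : DifferentiableAt ℂ S (σ : ℂ) := by
      refine (hd.mono (hball σ hσ0)).differentiableAt (Metric.ball_mem_nhds _ (by positivity))
    have h1 := HasDerivAt.scomp (𝕜' := ℂ) σ (g₁ := S) (h := fun σ : ℝ => (σ : ℂ))
      hdiff.hasDerivAt (Complex.ofRealCLM.hasDerivAt (x := σ))
    simp only [Complex.ofRealCLM_apply, Complex.ofReal_one, one_smul] at h1
    exact h1.hasDerivWithinAt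
  have := norm_image_sub_le_of_norm_deriv_le_segment' hpath (C := M / (s * κ / 2))
    (fun σ hσ => (hderiv σ (hs.trans_le hσ.1)).trans (by gcongr; exact hσ.1))
    (s + t) (Set.right_mem_Icc.2 (by linarith))
  rw [norm_sub_rev]
  refine this.trans (le_of_eq ?_)
  field_simp; ring

theorem sq_lintegral_mul_le {X : Type*} [MeasurableSpace X] {μ : Measure X} {f g : X → ℝ≥0∞}
    (hf : AEMeasurable f μ) (hg : AEMeasurable g μ) :
    (∫⁻ x, f x * g x ∂μ) ^ 2 ≤ (∫⁻ x, f x ^ 2 ∂μ) * ∫⁻ x, g x ^ 2 ∂μ := by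
  have h := ENNReal.lintegral_mul_le_Lp_mul_Lq μ Real.HolderConjugate.two_two hf hg
  simp only [Pi.mul_apply, ENNReal.rpow_two] at h
  refine (pow_le_pow_left' h 2).trans (le_of_eq ?_)
  rw [mul_pow, ← ENNReal.rpow_natCast, ← ENNReal.rpow_natCast, ← ENNReal.rpow_mul,
    ← ENNReal.rpow_mul]
  norm_num

theorem enorm_sq_eq_lintegral (u : L2Space n) :
    ‖u‖ₑ ^ 2 = ∫⁻ x, ‖(u : RSpace n → ℂ) x‖ₑ ^ 2 := by
  rw [Lp.enorm_def, eLpNorm_eq_lintegral_rpow_enorm_toReal (by norm_num) (by norm_num),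
    ← ENNReal.rpow_natCast, ← ENNReal.rpow_mul]
  norm_num

theorem lintegral_sq_gaussKernel {C A t : ℝ} (hC : 0 < C) (hA : 0 < A) (ht : 0 < t) :
    ∫⁻ x : RSpace n, ENNReal.ofReal (C * gaussKernel A t x) ^ 2
      = ENNReal.ofReal (C ^ 2 * (Real.pi / (2 * A)) ^ ((n : ℝ) / 2) / t ^ ((n : ℝ) / 2)) := by
  have e : ∀ x : RSpace n, ENNReal.ofReal (C * gaussKernel A t x) ^ 2
      = ENNReal.ofReal (C ^ 2 / t ^ ((n : ℝ) / 2)) * ENNReal.ofReal (gaussKernel (2 * A) t x) := by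
    intro x
    rw [← ENNReal.ofReal_pow (mul_nonneg hC.le (gaussKernel_nonneg A ht x)),
      ← ENNReal.ofReal_mul (by positivity)]
    congr 1
    unfold gaussKernel
    rw [show -(2 * A * ‖x‖ ^ 2 / t) = -(A * ‖x‖ ^ 2 / t) + -(A * ‖x‖ ^ 2 / t) by ring,
      Real.exp_add]
    ring
  simp_rw [e]
  rw [lintegral_const_mul _ (by fun_prop), lintegral_gaussKernel (by positivity) ht,
    ← ENNReal.ofReal_mul (by positivity)]
  congr 1; ring

/-- Lebesgue differentiation along balls that contain `y` but need not be centred there. Countably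
many balls suffice, so an exceptional null set in another variable can be chosen independently of
the ball. -/
theorem ae_norm_le_of_forall_closedBall {f : RSpace n → ℂ} (hf : LocallyIntegrable f) {M : ℝ}
    (h : ∀ j k : ℕ, ‖∫ y in Metric.closedBall (TopologicalSpace.denseSeq (RSpace n) j)
      (1 / ((k : ℝ) + 1)), f y‖ ≤ M * volume.real (Metric.closedBall
        (TopologicalSpace.denseSeq (RSpace n) j) (1 / ((k : ℝ) + 1)))) :
    ∀ᵐ y, ‖f y‖ ≤ M := by
  filter_upwards [IsUnifLocDoublingMeasure.ae_tendsto_average (μ := volume) hf 1] with y hy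
  have hpos : ∀ k : ℕ, 0 < 1 / ((k : ℝ) + 1) := fun k => by positivity
  have hex : ∀ k : ℕ, ∃ j, dist y (TopologicalSpace.denseSeq (RSpace n) j) < 1 / ((k : ℝ) + 1) :=
    fun k => (TopologicalSpace.denseRange_denseSeq (RSpace n)).exists_dist_lt y (hpos k)
  choose j hj using hex
  have hlim := hy (l := atTop) (fun k => TopologicalSpace.denseSeq (RSpace n) (j k))
    (fun k : ℕ => 1 / ((k : ℝ) + 1))
    (tendsto_nhdsWithin_iff.2 ⟨tendsto_one_div_add_atTop_nhds_zero_nat,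
      Eventually.of_forall hpos⟩)
    (Eventually.of_forall fun k => by rw [one_mul]; exact (hj k).le)
  refine le_of_tendsto hlim.norm (Eventually.of_forall fun k => ?_)
  have hvol : 0 < volume.real (Metric.closedBall
      (TopologicalSpace.denseSeq (RSpace n) (j k)) (1 / ((k : ℝ) + 1))) :=
    ENNReal.toReal_pos (Metric.measure_closedBall_pos _ _ (hpos k)).ne' measure_closedBall_lt_top.ne
  rw [setAverage_eq, norm_smul, norm_inv, Real.norm_of_nonneg hvol.le, inv_mul_le_iff₀ hvol,
    mul_comm]
  exact h (j k) k

end Semigroup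

/-! ### Kernel bounds for differences of the semigroup. -/

section Kernel

variable {n : ℕ} {S : ℂ → L2Space n →L[ℂ] L2Space n} {P : ℝ → RSpace n → RSpace n → ℂ}

theorem IsHeatKernel.measurable_right (hP : IsHeatKernel S P) (t : ℝ) (x : RSpace n) :
    Measurable (P t x) :=
  hP.1.comp (measurable_const.prodMk (measurable_const.prodMk measurable_id))

theorem integrable_gaussKernel {b t : ℝ} (hb : 0 < b) (ht : 0 < t) (x : RSpace n) :
    Integrable fun y : RSpace n => gaussKernel b t (x - y) := by
  have h : Integrable fun y : RSpace n => gaussKernel b t y := by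
    refine ⟨by fun_prop, ?_⟩
    rw [hasFiniteIntegral_iff_ofReal (ae_of_all _ fun x => gaussKernel_nonneg b ht x),
      lintegral_gaussKernel hb ht]
    exact ENNReal.ofReal_lt_top
  exact h.comp_sub_left x

theorem integrable_kernel (hP : IsHeatKernel S P) {C A : ℝ} (hA : 0 < A)
    (hG : ∀ t : ℝ, 0 < t → ∀ x y, ‖P t x y‖ ≤ C * gaussKernel A t (x - y)) {t : ℝ} (ht : 0 < t)
    (x : RSpace n) : Integrable (P t x) :=
  ((integrable_gaussKernel hA ht x).const_mul C).mono'
    (hP.measurable_right t x).aestronglyMeasurable (ae_of_all _ fun y => hG t ht x y)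

theorem enorm_kernel_le {C A : ℝ}
    (hG : ∀ t : ℝ, 0 < t → ∀ x y, ‖P t x y‖ ≤ C * gaussKernel A t (x - y)) {t : ℝ} (ht : 0 < t)
    (x y : RSpace n) : ‖P t x y‖ₑ ≤ ENNReal.ofReal (C * gaussKernel A t (x - y)) := by
  rw [← ofReal_norm]; exact ENNReal.ofReal_le_ofReal (hG t ht x y)

/-- The semigroup maps `L²` to `L^∞`. -/
theorem ae_enorm_sq_semigroup_le (hP : IsHeatKernel S P) {C A : ℝ} (hC : 0 < C) (hA : 0 < A)
    (hG : ∀ t : ℝ, 0 < t → ∀ x y, ‖P t x y‖ ≤ C * gaussKernel A t (x - y)) {t : ℝ} (ht : 0 < t)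
    (v : L2Space n) :
    ∀ᵐ x, ‖(S (t : ℂ) v : RSpace n → ℂ) x‖ₑ ^ 2 ≤ ENNReal.ofReal
      (C ^ 2 * (Real.pi / (2 * A)) ^ ((n : ℝ) / 2) / t ^ ((n : ℝ) / 2)) * ‖v‖ₑ ^ 2 := by
  filter_upwards [hP.2 t ht v] with x hx
  rw [hx, enorm_sq_eq_lintegral, ← lintegral_sq_gaussKernel hC hA ht,
    ← lintegral_sub_left_eq_self _ x]
  refine (pow_le_pow_left' (enorm_integral_le_lintegral_enorm _) 2).trans ?_
  calc _ ≤ (∫⁻ y, ENNReal.ofReal (C * gaussKernel A t (x - y)) * ‖(v : RSpace n → ℂ) y‖ₑ) ^ 2 := by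
        gcongr with y
        rw [enorm_mul]
        gcongr
        exact enorm_kernel_le hG ht x y
    _ ≤ _ := sq_lintegral_mul_le (by fun_prop) (Lp.aestronglyMeasurable v).enorm

/-- The semigroup maps `L¹` to `L²`, tested on indicator functions. -/
theorem enorm_sq_semigroup_indicator_le (hP : IsHeatKernel S P) {C A : ℝ} (hC : 0 < C) (hA : 0 < A)
    (hG : ∀ t : ℝ, 0 < t → ∀ x y, ‖P t x y‖ ≤ C * gaussKernel A t (x - y)) {t : ℝ} (ht : 0 < t)
    {B : Set (RSpace n)} (hB : MeasurableSet B) (hBt : volume B ≠ ∞) :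
    ‖S (t : ℂ) (indicatorConstLp 2 hB hBt (1 : ℂ))‖ₑ ^ 2 ≤ ENNReal.ofReal
      (C ^ 2 * (Real.pi / (2 * A)) ^ ((n : ℝ) / 2) / t ^ ((n : ℝ) / 2)) * volume B ^ 2 := by
  set u := indicatorConstLp 2 hB hBt (1 : ℂ) with hu
  have hu' : ∀ᵐ y, (u : RSpace n → ℂ) y = B.indicator (fun _ => (1 : ℂ)) y := indicatorConstLp_coeFn
  rw [enorm_sq_eq_lintegral]
  calc _ ≤ ∫⁻ x, volume B * ∫⁻ y in B, ENNReal.ofReal (C * gaussKernel A t (x - y)) ^ 2 := by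
        refine lintegral_mono_ae ?_
        filter_upwards [hP.2 t ht u] with x hx
        have h1 : ‖∫ y, P t x y * (u : RSpace n → ℂ) y‖ₑ
            ≤ ∫⁻ y in B, 1 * ENNReal.ofReal (C * gaussKernel A t (x - y)) := by
          refine (enorm_integral_le_lintegral_enorm _).trans ?_
          rw [← lintegral_indicator hB]
          refine lintegral_mono_ae ?_
          filter_upwards [hu'] with y hy
          rw [hy]
          by_cases hyB : y ∈ B
          · simpa [hyB] using enorm_kernel_le hG ht x y
          · simp [hyB]
        rw [hx]
        refine (pow_le_pow_left' h1 2).trans ?_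
        -- Cauchy–Schwarz against the constant 1 on `B` gives one factor `volume B`; the other
        -- appears after Fubini.
        refine (sq_lintegral_mul_le (by fun_prop) (by fun_prop)).trans (le_of_eq ?_)
        simp
    _ = volume B * ∫⁻ y in B, ∫⁻ x, ENNReal.ofReal (C * gaussKernel A t (x - y)) ^ 2 := by
        rw [lintegral_const_mul' _ _ hBt, lintegral_lintegral_swap]
        refine Measurable.aemeasurable ?_
        simp only [Function.uncurry_def]
        fun_prop
    _ = _ := by
        have : ∀ y : RSpace n, ∫⁻ x, ENNReal.ofReal (C * gaussKernel A t (x - y)) ^ 2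
            = ENNReal.ofReal
              (C ^ 2 * (Real.pi / (2 * A)) ^ ((n : ℝ) / 2) / t ^ ((n : ℝ) / 2)) := fun y => by
          rw [lintegral_sub_right_eq_self
            (fun x => ENNReal.ofReal (C * gaussKernel A t x) ^ 2), lintegral_sq_gaussKernel hC hA ht]
        simp_rw [this]
        rw [setLIntegral_const]; ring

/-- The kernel of `e^{-rL} - e^{-(r+t)L}` is small in the supremum norm. -/
theorem exists_ae_norm_kernel_sub_le (hS : IsBoundedAnalyticSemigroup S) (hP : IsHeatKernel S P)
    {C A : ℝ} (hC : 0 < C) (hA : 0 < A)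
    (hG : ∀ t : ℝ, 0 < t → ∀ x y, ‖P t x y‖ ≤ C * gaussKernel A t (x - y)) :
    ∃ M : ℝ, 0 ≤ M ∧ ∀ r t : ℝ, 0 < r → 0 < t → ∀ᵐ x, ∀ᵐ y,
      ‖P r x y - P (r + t) x y‖ ≤ M * (t / r) / r ^ ((n : ℝ) / 2) := by
  obtain ⟨D, hD0, hD⟩ := hS.exists_norm_sub_le
  obtain ⟨θ, hθ, -, hsg, -⟩ := hS
  set c0 := C ^ 2 * (Real.pi / (2 * A)) ^ ((n : ℝ) / 2) with hc0
  have hc0' : 0 ≤ c0 := by positivity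
  refine ⟨c0 * 3 ^ ((n : ℝ) / 2) * (D * 3), by positivity, fun r t hr ht => ?_⟩
  have hr3 : 0 < r / 3 := by positivity
  set s := r / 3 with hs
  have hsec : ∀ {a : ℝ}, 0 < a → (a : ℂ) ∈ openSector θ := fun ha => ofReal_mem_openSector hθ ha
  have hrs : (r : ℂ) = (s : ℂ) + ((s : ℂ) + (s : ℂ)) := by
    rw [hs]; push_cast; ring
  have hrts : ((r + t : ℝ) : ℂ) = (s : ℂ) + (((s + t : ℝ) : ℂ) + (s : ℂ)) := by
    rw [hs]; push_cast; ring
  -- With `s = r/3`, both `r = s + s + s` and `r + t = s + (s + t) + s` share their outer factors;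
  -- only the middle one changes.
  have hfac : ∀ u : L2Space n, S (r : ℂ) u - S ((r + t : ℝ) : ℂ) u
      = S (s : ℂ) ((S (s : ℂ) - S ((s + t : ℝ) : ℂ)) (S (s : ℂ) u)) := fun u => by
    have h1 : S (r : ℂ) = (S s).comp ((S s).comp (S s)) := by
      rw [hrs, hsg _ (hsec hr3) _ (by simpa using hsec (add_pos hr3 hr3)),
        hsg _ (hsec hr3) _ (hsec hr3)]
    have hst : 0 < s + t := by positivity
    have h2 : S ((r + t : ℝ) : ℂ) = (S s).comp ((S ((s + t : ℝ) : ℂ)).comp (S s)) := by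
      rw [hrts, hsg _ (hsec hr3) _ (by
        have := hsec (add_pos hst hr3)
        rw [Complex.ofReal_add] at this
        exact this), hsg _ (hsec hst) _ (hsec hr3)]
    rw [h1, h2]
    simp
  set Γ := c0 / s ^ ((n : ℝ) / 2) with hΓ
  have hΓ0 : 0 ≤ Γ := by positivity
  set δ := D * (t / s) with hδ
  have hδ0 : 0 ≤ δ := by positivity
  -- Testing on indicators: `L¹ → L²` and `L² → L^∞` each cost `√Γ`, and the middle factor costs
  -- `δ`.
  have hbound : ∀ {B : Set (RSpace n)} (hB : MeasurableSet B) (hBt : volume B ≠ ∞),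
      ∀ᵐ x, ‖∫ y in B, (P r x y - P (r + t) x y)‖ ≤ Γ * δ * volume.real B := by
    intro B hB hBt
    set u := indicatorConstLp 2 hB hBt (1 : ℂ) with hu
    have hu' : ∀ᵐ y, (u : RSpace n → ℂ) y = B.indicator (fun _ => (1 : ℂ)) y :=
      indicatorConstLp_coeFn
    have hint : ∀ a : ℝ, ∀ x, ∫ y, P a x y * (u : RSpace n → ℂ) y = ∫ y in B, P a x y := by
      intro a x
      rw [← integral_indicator hB]
      refine integral_congr_ae ?_
      filter_upwards [hu'] with y hy
      rw [hy]
      by_cases hyB : y ∈ B <;> simp [hyB]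
    set w := (S (s : ℂ) - S ((s + t : ℝ) : ℂ)) (S (s : ℂ) u) with hw
    have hwn : ‖w‖ₑ ^ 2 ≤ ENNReal.ofReal δ ^ 2 * (ENNReal.ofReal Γ * volume B ^ 2) := by
      have h1 : ‖w‖ₑ ≤ ENNReal.ofReal δ * ‖S (s : ℂ) u‖ₑ := by
        rw [← ofReal_norm, ← ofReal_norm, ← ENNReal.ofReal_mul hδ0]
        refine ENNReal.ofReal_le_ofReal ((ContinuousLinearMap.le_opNorm _ _).trans ?_)
        gcongr
        exact hD s t hr3 ht
      refine (pow_le_pow_left' h1 2).trans ?_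
      rw [mul_pow]
      gcongr
      exact enorm_sq_semigroup_indicator_le hP hC hA hG hr3 hB hBt
    filter_upwards [hP.2 r hr u, hP.2 (r + t) (by positivity) u,
      Lp.coeFn_sub (S (r : ℂ) u) (S ((r + t : ℝ) : ℂ) u),
      ae_enorm_sq_semigroup_le hP hC hA hG hr3 w] with x h1 h2 h3 h4
    rw [integral_sub (integrable_kernel hP hA hG hr x).integrableOn
      (integrable_kernel hP hA hG (add_pos hr ht) x).integrableOn, ← hint, ← hint, ← h1, ← h2]
    rw [hfac u, Pi.sub_apply] at h3
    rw [← h3]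
    have h5 : ‖(S (s : ℂ) w : RSpace n → ℂ) x‖ₑ ^ 2
        ≤ (ENNReal.ofReal (Γ * δ * volume.real B)) ^ 2 := by
      refine h4.trans ?_
      rw [ENNReal.ofReal_mul (by positivity), ENNReal.ofReal_mul hΓ0, ofReal_measureReal hBt]
      calc _ ≤ ENNReal.ofReal Γ * (ENNReal.ofReal δ ^ 2 * (ENNReal.ofReal Γ * volume B ^ 2)) := by
            gcongr
        _ = _ := by ring
    have h6 := (ENNReal.pow_le_pow_left_iff two_ne_zero).1 h5
    rw [← ofReal_norm] at h6
    exact (ENNReal.ofReal_le_ofReal_iff (by positivity)).1 h6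
  have hall : ∀ᵐ x, ∀ j k : ℕ, ‖∫ y in Metric.closedBall (TopologicalSpace.denseSeq (RSpace n) j)
      (1 / ((k : ℝ) + 1)), (P r x y - P (r + t) x y)‖ ≤ Γ * δ * volume.real (Metric.closedBall
        (TopologicalSpace.denseSeq (RSpace n) j) (1 / ((k : ℝ) + 1))) :=
    ae_all_iff.2 fun j => ae_all_iff.2 fun k =>
      hbound Metric.isClosed_closedBall.measurableSet measure_closedBall_lt_top.ne
  have hconst : Γ * δ = c0 * 3 ^ ((n : ℝ) / 2) * (D * 3) * (t / r) / r ^ ((n : ℝ) / 2) := by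
    rw [hΓ, hδ, hs, Real.div_rpow hr.le (by norm_num)]; field_simp
  filter_upwards [hall] with x hx
  rw [← hconst]
  exact ae_norm_le_of_forall_closedBall ((integrable_kernel hP hA hG hr x).sub
    (integrable_kernel hP hA hG (add_pos hr ht) x)).locallyIntegrable hx

theorem gaussKernel_le_half {A r s : ℝ} (hA : 0 < A) (hr : 0 < r) (hrs : r ≤ s) (hs : s ≤ 2 * r)
    (x : RSpace n) : gaussKernel A s x ≤ gaussKernel (A / 2) r x := by
  unfold gaussKernel
  have hs0 : 0 < s := hr.trans_le hrs
  have h : A / 2 * ‖x‖ ^ 2 / r ≤ A * ‖x‖ ^ 2 / s := by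
    rw [div_le_div_iff₀ hr hs0]
    nlinarith [mul_nonneg hA.le (sq_nonneg ‖x‖)]
  gcongr ?_ / ?_
  · exact Real.exp_le_exp.2 (neg_le_neg h)
  · gcongr

/-- Gaussian estimate for the kernel of `e^{-rL} - e^{-(r+t)L}`, with a gain for small `t / r`. -/
theorem exists_ae_norm_kernel_sub_le_gaussKernel (hS : IsBoundedAnalyticSemigroup S)
    (hP : IsHeatKernel S P) {C A : ℝ} (hC : 0 < C) (hA : 0 < A)
    (hG : ∀ t : ℝ, 0 < t → ∀ x y, ‖P t x y‖ ≤ C * gaussKernel A t (x - y)) :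
    ∃ M : ℝ, 0 ≤ M ∧ ∀ r t : ℝ, 0 < t → t ≤ r → ∀ᵐ x, ∀ᵐ y,
      ‖P r x y - P (r + t) x y‖ ≤ M * √(t / r) * gaussKernel (A / 4) r (x - y) := by
  obtain ⟨M, hM0, hM⟩ := exists_ae_norm_kernel_sub_le hS hP hC hA hG
  refine ⟨√(2 * C * M), by positivity, fun r t ht htr => ?_⟩
  have hr : 0 < r := ht.trans_le htr
  filter_upwards [hM r t hr ht] with x hx
  filter_upwards [hx] with y hy
  set z := x - y with hz
  have h1 : ‖P r x y - P (r + t) x y‖ ≤ 2 * C * gaussKernel (A / 2) r z := by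
    calc _ ≤ ‖P r x y‖ + ‖P (r + t) x y‖ := norm_sub_le _ _
      _ ≤ C * gaussKernel (A / 2) r z + C * gaussKernel (A / 2) r z := by
          gcongr
          · exact (hG r hr x y).trans
              (by gcongr; exact gaussKernel_le_half hA hr le_rfl (by linarith) _)
          · exact (hG _ (by positivity) x y).trans
              (by gcongr; exact gaussKernel_le_half hA hr (by linarith) (by linarith) _)
      _ = _ := by ring
  have hg4 : 0 ≤ gaussKernel (A / 4) r z := gaussKernel_nonneg _ hr z
  -- Geometric mean of the uniform bound and the Gaussian bound: the square root halves the exponent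
  -- `A/2` to `A/4` and turns `t/r` into `√(t/r)`.
  have h2 : ‖P r x y - P (r + t) x y‖ ^ 2 ≤ (√(2 * C * M) * √(t / r) * gaussKernel (A / 4) r z) ^ 2 := by
    rw [mul_pow, mul_pow, Real.sq_sqrt (by positivity), Real.sq_sqrt (by positivity), sq]
    calc _ ≤ (M * (t / r) / r ^ ((n : ℝ) / 2)) * (2 * C * gaussKernel (A / 2) r z) := by gcongr
      _ = _ := by
          unfold gaussKernel
          rw [show -(A / 2 * ‖z‖ ^ 2 / r) = -(A / 4 * ‖z‖ ^ 2 / r) + -(A / 4 * ‖z‖ ^ 2 / r) by ring,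
            Real.exp_add]
          ring
  exact (pow_le_pow_iff_left₀ (norm_nonneg _) (by positivity) two_ne_zero).1 h2

end Kernel

/-! ### Heat integrals of Morrey functions and the difference operator. -/

section Heat

variable {n : ℕ} {S : ℂ → L2Space n →L[ℂ] L2Space n} {P : ℝ → RSpace n → RSpace n → ℂ}

theorem exists_ballGrowth_of_morreyNorm (hn : 0 < n) {α p lam : ℝ} (hαn : α < n) (hp : 1 ≤ p)
    (hlam : lam = n - α * p) :
    ∃ W : ℝ≥0, ∀ f : RSpace n → ℂ, AEStronglyMeasurable f →
      BallGrowth (n - α) (W * morreyNorm p lam f) fun y => ‖f y‖ₑ := by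
  have hn' : (0 : ℝ) < n := by exact_mod_cast hn
  have hp0 : 0 < p := by linarith
  set ω := volume (Metric.ball (0 : RSpace n) 1) with hω
  have hωt : ω ≠ ∞ := measure_ball_lt_top.ne
  set e := 1 - α / n with he
  have he0 : 0 ≤ e := by
    rw [he, sub_nonneg, div_le_one hn']; exact hαn.le
  refine ⟨(ω ^ e).toNNReal, fun f hf c r hr => ?_⟩
  rw [ENNReal.coe_toNNReal (ENNReal.rpow_ne_top_of_nonneg he0 hωt)]
  set B := Metric.ball c r with hB
  have hB0 : volume B ≠ 0 := (Metric.measure_ball_pos _ _ hr).ne'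
  have hBt : volume B ≠ ∞ := measure_ball_lt_top.ne
  have h1 : eLpNorm f (ENNReal.ofReal p) (volume.restrict B)
      ≤ morreyNorm p lam f * volume B ^ (lam / (p * n)) := by
    rw [← ENNReal.div_le_iff (by simp [ENNReal.rpow_eq_zero_iff, hB0, hBt])
      (by simp [ENNReal.rpow_eq_top_iff, hB0, hBt])]
    exact le_iSup_of_le c (le_iSup_of_le r (le_iSup_of_le hr le_rfl))
  have h2 := eLpNorm_le_eLpNorm_mul_rpow_measure_univ (p := 1) (q := ENNReal.ofReal p)
    (μ := volume.restrict B) (f := f) (by simpa using hp) hf.restrict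
  rw [eLpNorm_one_eq_lintegral_enorm, Measure.restrict_apply_univ, ENNReal.toReal_one,
    ENNReal.toReal_ofReal hp0.le] at h2
  refine h2.trans ((mul_le_mul_left h1 _).trans (le_of_eq ?_))
  rw [mul_assoc, ← ENNReal.rpow_add _ _ hB0 hBt]
  -- The relation `λ = n - αp` makes `p` cancel between the Morrey weight and Hölder's factor.
  have h3 : lam / (p * n) + (1 / 1 - 1 / p) = e := by
    rw [he, hlam]; field_simp; ring
  rw [h3, volume_ball_eq c hr, ENNReal.mul_rpow_of_nonneg _ _ he0,
    ENNReal.ofReal_rpow_of_nonneg (by positivity) he0, ← Real.rpow_mul hr.le,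
    show (n : ℝ) * e = n - α by rw [he]; field_simp]
  ring

theorem heat_congr_ae {f g : RSpace n → ℂ} (h : f =ᵐ[volume] g) (t : ℝ) : heat P t f = heat P t g := by
  funext x
  exact integral_congr_ae (h.mono fun y hy => by simp only [hy])

theorem lintegral_enorm_kernel_mul_le {C A : ℝ} (hC : 0 < C)
    (hG : ∀ t : ℝ, 0 < t → ∀ x y, ‖P t x y‖ ≤ C * gaussKernel A t (x - y)) {t : ℝ} (ht : 0 < t)
    {f : RSpace n → ℂ} (hf : Measurable f) (x : RSpace n) :
    ∫⁻ y, ‖P t x y * f y‖ₑ ≤ ENNReal.ofReal C * gaussConv A t (fun y => ‖f y‖ₑ) x := by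
  unfold gaussConv
  rw [← lintegral_const_mul _ (by fun_prop)]
  refine lintegral_mono fun y => ?_
  rw [enorm_mul, ← mul_assoc, ← ENNReal.ofReal_mul hC.le]
  gcongr
  exact enorm_kernel_le hG ht x y

theorem enorm_heat_le {C A : ℝ} (hC : 0 < C)
    (hG : ∀ t : ℝ, 0 < t → ∀ x y, ‖P t x y‖ ≤ C * gaussKernel A t (x - y)) {t : ℝ} (ht : 0 < t)
    {f : RSpace n → ℂ} (hf : Measurable f) (x : RSpace n) :
    ‖heat P t f x‖ₑ ≤ ENNReal.ofReal C * gaussConv A t (fun y => ‖f y‖ₑ) x :=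
  (enorm_integral_le_lintegral_enorm _).trans (lintegral_enorm_kernel_mul_le hC hG ht hf x)

theorem measurable_heat_uncurry (hPm : Measurable fun q : ℝ × RSpace n × RSpace n => P q.1 q.2.1 q.2.2)
    {f : RSpace n → ℂ} (hf : Measurable f) :
    Measurable fun q : ℝ × RSpace n => heat P q.1 f q.2 := by
  have h : StronglyMeasurable fun z : (ℝ × RSpace n) × RSpace n => P z.1.1 z.1.2 z.2 * f z.2 := by
    refine Measurable.stronglyMeasurable (Measurable.mul ?_ (hf.comp measurable_snd))
    exact hPm.comp ((measurable_fst.comp measurable_fst).prodMk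
      ((measurable_snd.comp measurable_fst).prodMk measurable_snd))
  exact h.integral_prod_right'.measurable

theorem integrable_kernel_mul (hP : IsHeatKernel S P) {α C A : ℝ} (hC : 0 < C) (hA : 0 < A)
    (hG : ∀ t : ℝ, 0 < t → ∀ x y, ‖P t x y‖ ≤ C * gaussKernel A t (x - y))
    {K : ℝ≥0∞} (hKt : K ≠ ∞) {f : RSpace n → ℂ} (hf : Measurable f)
    (hK : BallGrowth (n - α) K fun y => ‖f y‖ₑ) {t : ℝ} (ht : 0 < t) (x : RSpace n) :
    Integrable fun y => P t x y * f y := by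
  obtain ⟨D, hD⟩ := exists_gaussConv_le n α hA
  refine ⟨((hP.measurable_right t x).mul hf).aestronglyMeasurable, ?_⟩
  refine (lintegral_enorm_kernel_mul_le hC hG ht hf x).trans_lt ?_
  refine ENNReal.mul_lt_top ENNReal.ofReal_lt_top ((hD K _ hf.enorm hK t ht x).trans_lt ?_)
  exact ENNReal.mul_lt_top (ENNReal.mul_lt_top ENNReal.coe_lt_top hKt.lt_top) ENNReal.ofReal_lt_top

/-- Pointwise control of the integrand of the difference operator. -/
theorem exists_ae_lintegral_heat_sub_le (hS : IsBoundedAnalyticSemigroup S)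
    (hP : IsHeatKernel S P) {α C A : ℝ} (hα : 0 < α) (hC : 0 < C) (hA : 0 < A)
    (hG : ∀ t : ℝ, 0 < t → ∀ x y, ‖P t x y‖ ≤ C * gaussKernel A t (x - y)) :
    ∃ D : ℝ≥0, ∀ (K : ℝ≥0∞) (f : RSpace n → ℂ), K ≠ ∞ → Measurable f →
      BallGrowth (n - α) K (fun y => ‖f y‖ₑ) → ∀ t : ℝ, 0 < t → ∀ᵐ x,
      ∫⁻ s in Set.Ioi (0 : ℝ), ENNReal.ofReal (s ^ (α / 2 - 1)) *
        ‖heat P s f x - heat P (s + t) f x‖ₑ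
      ≤ ENNReal.ofReal C * (∫⁻ s in Set.Ioc 0 t,
          ENNReal.ofReal (s ^ (α / 2 - 1)) * gaussConv A s (fun y => ‖f y‖ₑ) x) + D * K := by
  obtain ⟨D₁, hD₁⟩ := exists_gaussConv_le n α hA
  obtain ⟨D₂, hD₂⟩ := exists_gaussConv_le n α (b := A / 4) (by positivity)
  obtain ⟨M, hM0, hM⟩ := exists_ae_norm_kernel_sub_le_gaussKernel hS hP hC hA hG
  refine ⟨C.toNNReal * D₁ * (2 / α).toNNReal + M.toNNReal * D₂ * 2,
    fun K f hKt hf hK t ht => ?_⟩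
  have hhm := measurable_heat_uncurry hP.1 hf
  have hdm : Measurable fun q : ℝ × RSpace n => ‖heat P q.1 f q.2 - heat P (q.1 + t) f q.2‖ₑ := by
    refine Measurable.enorm (hhm.sub (hhm.comp (Measurable.prodMk ?_ measurable_snd)))
    fun_prop
  have hlarge : ∀ s : ℝ, t < s → ∀ᵐ x, ‖heat P s f x - heat P (s + t) f x‖ₑ
      ≤ ENNReal.ofReal (M * √(t / s)) * (D₂ * K * ENNReal.ofReal (s ^ (-(α / 2)))) := by
    intro s hs
    have hs0 : 0 < s := ht.trans hs
    filter_upwards [hM s t ht hs.le] with x hx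
    unfold heat
    rw [← integral_sub (integrable_kernel_mul hP hC hA hG hKt hf hK hs0 x)
      (integrable_kernel_mul hP hC hA hG hKt hf hK (add_pos hs0 ht) x)]
    refine (enorm_integral_le_lintegral_enorm _).trans ?_
    refine le_trans ?_ (mul_le_mul_right (hD₂ K _ hf.enorm hK s hs0 x) _)
    unfold gaussConv
    rw [← lintegral_const_mul _ (by fun_prop)]
    refine lintegral_mono_ae ?_
    filter_upwards [hx] with y hy
    rw [← sub_mul, enorm_mul, ← mul_assoc, ← ENNReal.ofReal_mul (by positivity)]
    gcongr
    rw [← ofReal_norm]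
    exact ENNReal.ofReal_le_ofReal hy
  -- The null set of `x` in `hlarge` depends on `s`; Fubini exchanges the quantifiers.
  have hlarge' : ∀ᵐ x : RSpace n, ∀ᵐ s ∂(volume.restrict (Set.Ioi t)),
      ‖heat P s f x - heat P (s + t) f x‖ₑ
      ≤ ENNReal.ofReal (M * √(t / s)) * (D₂ * K * ENNReal.ofReal (s ^ (-(α / 2)))) := by
    rw [← Measure.ae_ae_comm]
    · exact (ae_restrict_mem measurableSet_Ioi).mono hlarge
    · refine measurableSet_le hdm ?_
      fun_prop
  filter_upwards [hlarge'] with x hx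
  rw [← Set.Ioc_union_Ioi_eq_Ioi ht.le,
    lintegral_union measurableSet_Ioi (Set.Ioc_disjoint_Ioi le_rfl)]
  push_cast
  rw [add_mul, ← add_assoc]
  -- The two heat integrals are estimated separately. The one at time `s + t ≥ t` is at most a
  -- multiple of `K t^(-α/2)`, which cancels `∫_0^t s^(α/2-1) ds`; the one at time `s` is kept for
  -- integration over a ball.
  have e1 : ∫⁻ s in Set.Ioc 0 t, ENNReal.ofReal (s ^ (α / 2 - 1)) *
        ‖heat P s f x - heat P (s + t) f x‖ₑ
      ≤ ENNReal.ofReal C * (∫⁻ s in Set.Ioc 0 t,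
          ENNReal.ofReal (s ^ (α / 2 - 1)) * gaussConv A s (fun y => ‖f y‖ₑ) x)
        + ENNReal.ofReal C * D₁ * ENNReal.ofReal (2 / α) * K := by
    calc _ ≤ ∫⁻ s in Set.Ioc 0 t, (ENNReal.ofReal C * (ENNReal.ofReal (s ^ (α / 2 - 1)) *
              gaussConv A s (fun y => ‖f y‖ₑ) x) +
            ENNReal.ofReal C * D₁ * K * ENNReal.ofReal (t ^ (-(α / 2))) *
              ENNReal.ofReal (s ^ (α / 2 - 1))) := by
          refine setLIntegral_mono' measurableSet_Ioc fun s hs => ?_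
          have hs0 : 0 < s := hs.1
          calc _ ≤ ENNReal.ofReal (s ^ (α / 2 - 1)) *
                (‖heat P s f x‖ₑ + ‖heat P (s + t) f x‖ₑ) := by gcongr; exact enorm_sub_le
            _ ≤ ENNReal.ofReal (s ^ (α / 2 - 1)) *
                (ENNReal.ofReal C * gaussConv A s (fun y => ‖f y‖ₑ) x +
                  ENNReal.ofReal C * (D₁ * K * ENNReal.ofReal (t ^ (-(α / 2))))) := by
                gcongr
                · exact enorm_heat_le hC hG hs0 hf x
                · refine (enorm_heat_le hC hG (add_pos hs0 ht) hf x).trans ?_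
                  gcongr
                  refine (hD₁ K _ hf.enorm hK _ (add_pos hs0 ht) x).trans ?_
                  refine mul_le_mul_right (ENNReal.ofReal_le_ofReal ?_) _
                  exact Real.rpow_le_rpow_of_nonpos ht (le_add_of_nonneg_left hs0.le)
                    (neg_nonpos.2 (half_pos hα).le)
            _ = _ := by ring
      _ = ENNReal.ofReal C * (∫⁻ s in Set.Ioc 0 t,
            ENNReal.ofReal (s ^ (α / 2 - 1)) * gaussConv A s (fun y => ‖f y‖ₑ) x) +
          ENNReal.ofReal C * D₁ * K * (ENNReal.ofReal (t ^ (-(α / 2))) *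
              ENNReal.ofReal (t ^ (α / 2 - 1 + 1) / (α / 2 - 1 + 1))) := by
          have hfe := hf.enorm
          rw [lintegral_add_left (by fun_prop), lintegral_const_mul _ (by fun_prop),
            lintegral_const_mul _ (by fun_prop), lintegral_Ioc_zero_rpow (by linarith) ht,
            mul_assoc _ (ENNReal.ofReal (t ^ (-(α / 2))))]
      _ = _ := by
          rw [← ENNReal.ofReal_mul (by positivity)]
          have : t ^ (-(α / 2)) * (t ^ (α / 2 - 1 + 1) / (α / 2 - 1 + 1)) = 2 / α := by
            rw [sub_add_cancel, Real.rpow_neg ht.le]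
            have := (Real.rpow_pos_of_pos ht (α / 2)).ne'
            field_simp
          rw [this]; ring
  -- The gain `√(t/s)` is what makes the integral converge at infinity: the powers combine to `√t
  -- s^(-3/2)`, whose integral is 2.
  have e2 : ∫⁻ s in Set.Ioi t, ENNReal.ofReal (s ^ (α / 2 - 1)) *
        ‖heat P s f x - heat P (s + t) f x‖ₑ ≤ ENNReal.ofReal M * D₂ * 2 * K := by
    calc _ ≤ ∫⁻ s in Set.Ioi t, ENNReal.ofReal M * D₂ * K * ENNReal.ofReal √t *
            ENNReal.ofReal (s ^ (-(3 / 2) : ℝ)) := by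
          refine lintegral_mono_ae ?_
          filter_upwards [hx, ae_restrict_mem measurableSet_Ioi] with s hs hts
          have hs0 : 0 < s := ht.trans hts
          refine (mul_le_mul_right hs _).trans (le_of_eq ?_)
          have e3 : ENNReal.ofReal (s ^ (-(3 / 2) : ℝ)) = ENNReal.ofReal (s ^ (α / 2 - 1)) *
              ENNReal.ofReal (s ^ (-(1 / 2) : ℝ)) * ENNReal.ofReal (s ^ (-(α / 2))) := by
            rw [← ENNReal.ofReal_mul (by positivity), ← ENNReal.ofReal_mul (by positivity),
              ← Real.rpow_add hs0, ← Real.rpow_add hs0]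
            congr 2; ring
          have e4 : √(t / s) = √t * s ^ (-(1 / 2) : ℝ) := by
            rw [Real.sqrt_div ht.le, Real.sqrt_eq_rpow s, Real.rpow_neg hs0.le, div_eq_mul_inv]
          rw [e3, e4, ENNReal.ofReal_mul hM0, ENNReal.ofReal_mul (by positivity)]
          ring
      _ = ENNReal.ofReal M * D₂ * K * (ENNReal.ofReal √t *
            ENNReal.ofReal (t ^ (-(3 / 2) + 1 : ℝ) / -(-(3 / 2) + 1 : ℝ))) := by
          rw [lintegral_const_mul _ (by fun_prop), lintegral_Ioi_rpow (by norm_num) ht,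
            mul_assoc _ (ENNReal.ofReal √t)]
      _ = _ := by
          rw [← ENNReal.ofReal_mul (by positivity)]
          have : √t * (t ^ (-(3 / 2) + 1 : ℝ) / -(-(3 / 2) + 1 : ℝ)) = 2 := by
            rw [show (-(3 / 2) + 1 : ℝ) = -(1 / 2) by norm_num, Real.rpow_neg ht.le,
              ← Real.sqrt_eq_rpow]
            have := (Real.sqrt_pos.2 ht).ne'
            field_simp
          rw [this, show ENNReal.ofReal 2 = 2 by norm_num]; ring
  exact add_le_add e1 e2

/-- The integrated form of the estimate for the difference operator. -/
theorem exists_setLIntegral_heat_sub_le (hS : IsBoundedAnalyticSemigroup S)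
    (hP : IsHeatKernel S P) {α C A : ℝ} (hα : 0 < α) (hC : 0 < C) (hA : 0 < A)
    (hG : ∀ t : ℝ, 0 < t → ∀ x y, ‖P t x y‖ ≤ C * gaussKernel A t (x - y)) :
    ∃ D : ℝ≥0, ∀ (K : ℝ≥0∞) (f : RSpace n → ℂ), K ≠ ∞ → Measurable f →
      BallGrowth (n - α) K (fun y => ‖f y‖ₑ) → ∀ t R : ℝ, 0 < t → 0 < R → ∀ c : RSpace n,
      ∫⁻ x in Metric.ball c R, ∫⁻ s in Set.Ioi (0 : ℝ), ENNReal.ofReal (s ^ (α / 2 - 1)) *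
        ‖heat P s f x - heat P (s + t) f x‖ₑ
      ≤ D * K * (ENNReal.ofReal (R ^ ((n : ℝ) - α)) * ENNReal.ofReal (t ^ (α / 2))
        + ENNReal.ofReal (R ^ (n : ℝ))) := by
  obtain ⟨D, hD⟩ := exists_ae_lintegral_heat_sub_le hS hP hα hC hA hG
  set ω := volume (Metric.ball (0 : RSpace n) 1) with hω
  have hωt : ω ≠ ∞ := measure_ball_lt_top.ne
  set D₁ : ℝ≥0 := C.toNNReal * ((Real.pi / A) ^ ((n : ℝ) / 2)).toNNReal * (2 / α).toNNReal with hD₁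
  refine ⟨D₁ + D * ω.toNNReal, fun K f hKt hf hK t R ht hR c => ?_⟩
  have hfe := hf.enorm
  calc _ ≤ ∫⁻ x in Metric.ball c R, (ENNReal.ofReal C * (∫⁻ s in Set.Ioc 0 t,
          ENNReal.ofReal (s ^ (α / 2 - 1)) * gaussConv A s (fun y => ‖f y‖ₑ) x) + D * K) :=
        lintegral_mono_ae (ae_restrict_of_ae (hD K f hKt hf hK t ht))
    _ = ENNReal.ofReal C * (∫⁻ x in Metric.ball c R, ∫⁻ s in Set.Ioc 0 t,
          ENNReal.ofReal (s ^ (α / 2 - 1)) * gaussConv A s (fun y => ‖f y‖ₑ) x)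
          + D * K * (ENNReal.ofReal (R ^ (n : ℝ)) * ω) := by
        rw [lintegral_add_right _ measurable_const, lintegral_const_mul' _ _ ENNReal.ofReal_ne_top,
          setLIntegral_const, volume_ball_eq c hR]
    _ ≤ ENNReal.ofReal C * (ENNReal.ofReal ((Real.pi / A) ^ ((n : ℝ) / 2)) *
          (K * ENNReal.ofReal (R ^ ((n : ℝ) - α))) * ENNReal.ofReal (2 / α * t ^ (α / 2)))
          + D * K * (ENNReal.ofReal (R ^ (n : ℝ)) * ω) := by
        gcongr
        exact setLIntegral_rpow_mul_gaussConv_le hα hfe hK hA ht c hR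
    _ = D₁ * K * (ENNReal.ofReal (R ^ ((n : ℝ) - α)) * ENNReal.ofReal (t ^ (α / 2)))
          + (D * ω) * K * ENNReal.ofReal (R ^ (n : ℝ)) := by
        rw [ENNReal.ofReal_mul (by positivity), hD₁]
        simp only [ENNReal.coe_mul, ENNReal.ofReal]
        ring
    _ ≤ _ := by
        rw [ENNReal.coe_add, ENNReal.coe_mul D, ENNReal.coe_toNNReal hωt, mul_add]
        gcongr
        · exact le_self_add
        · exact le_add_self

theorem ae_lintegral_heat_sub_lt_top (hS : IsBoundedAnalyticSemigroup S)
    (hP : IsHeatKernel S P) {α C A : ℝ} (hα : 0 < α) (hC : 0 < C) (hA : 0 < A)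
    (hG : ∀ t : ℝ, 0 < t → ∀ x y, ‖P t x y‖ ≤ C * gaussKernel A t (x - y))
    {K : ℝ≥0∞} (hKt : K ≠ ∞) {f : RSpace n → ℂ} (hf : Measurable f)
    (hK : BallGrowth (n - α) K fun y => ‖f y‖ₑ) {t : ℝ} (ht : 0 < t) :
    ∀ᵐ x, ∫⁻ s in Set.Ioi (0 : ℝ), ENNReal.ofReal (s ^ (α / 2 - 1)) *
        ‖heat P s f x - heat P (s + t) f x‖ₑ < ∞ := by
  obtain ⟨D, hD⟩ := exists_setLIntegral_heat_sub_le hS hP hα hC hA hG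
  have hhm := measurable_heat_uncurry hP.1 hf
  have hm : Measurable fun x : RSpace n => ∫⁻ s in Set.Ioi (0 : ℝ),
      ENNReal.ofReal (s ^ (α / 2 - 1)) * ‖heat P s f x - heat P (s + t) f x‖ₑ := by
    have h0 : Measurable fun q : RSpace n × ℝ => ENNReal.ofReal (q.2 ^ (α / 2 - 1)) *
        ‖heat P q.2 f q.1 - heat P (q.2 + t) f q.1‖ₑ := by
      refine Measurable.mul (by fun_prop) (Measurable.enorm (Measurable.sub ?_ ?_))
      · exact hhm.comp measurable_swap
      · exact hhm.comp (Measurable.prodMk (measurable_snd.add_const t) measurable_fst)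
    exact h0.lintegral_prod_right'
  have hk : ∀ k : ℕ, ∀ᵐ x, x ∈ Metric.ball (0 : RSpace n) ((k : ℝ) + 1) →
      ∫⁻ s in Set.Ioi (0 : ℝ), ENNReal.ofReal (s ^ (α / 2 - 1)) *
        ‖heat P s f x - heat P (s + t) f x‖ₑ < ∞ := fun k => by
    rw [← ae_restrict_iff' measurableSet_ball]
    refine ae_lt_top hm ((hD K f hKt hf hK t ((k : ℝ) + 1) ht (by positivity) 0).trans_lt ?_).ne
    refine ENNReal.mul_lt_top (ENNReal.mul_lt_top ENNReal.coe_lt_top hKt.lt_top) ?_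
    exact ENNReal.add_lt_top.2 ⟨ENNReal.mul_lt_top ENNReal.ofReal_lt_top ENNReal.ofReal_lt_top,
      ENNReal.ofReal_lt_top⟩
  filter_upwards [ae_all_iff.2 hk] with x hx
  obtain ⟨k, hk⟩ := exists_nat_gt ‖x‖
  exact hx k (by rw [mem_ball_zero_iff]; linarith)

end Heat

/-! ### The fractional integral: convergence, commutation with the semigroup, oscillation. -/

section FractionalIntegral

variable {n : ℕ} {S : ℂ → L2Space n →L[ℂ] L2Space n} {P : ℝ → RSpace n → RSpace n → ℂ}

theorem measurable_rpow_smul_heat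
    (hPm : Measurable fun q : ℝ × RSpace n × RSpace n => P q.1 q.2.1 q.2.2) (α : ℝ)
    {f : RSpace n → ℂ} (hf : Measurable f) :
    Measurable fun q : RSpace n × ℝ => q.2 ^ (α / 2 - 1) • heat P q.2 f q.1 := by
  refine Measurable.smul (measurable_snd.pow_const _) ?_
  exact (measurable_heat_uncurry hPm hf).comp measurable_swap

theorem enorm_rpow_smul {s : ℝ} (hs : 0 < s) (a : ℝ) (z : ℂ) :
    ‖s ^ a • z‖ₑ = ENNReal.ofReal (s ^ a) * ‖z‖ₑ := by
  rw [enorm_smul, Real.enorm_of_nonneg (by positivity)]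

/-- Everything is dominated by the Gaussian potential `F`. Its finiteness almost everywhere comes
from the Riesz potential, and its weighted square integrability from the quadratic growth, for which
finiteness of the Riesz potential at a single point `x₀` is enough. -/
theorem fracIntConverges_of_rieszAbs
    (hPm : Measurable fun q : ℝ × RSpace n × RSpace n => P q.1 q.2.1 q.2.2) {α C A : ℝ}
    (hα : 0 < α) (hαn : α < n) (hC : 0 < C) (hA : 0 < A)
    (hG : ∀ t : ℝ, 0 < t → ∀ x y, ‖P t x y‖ ≤ C * gaussKernel A t (x - y))
    {K : ℝ≥0∞} (hKt : K ≠ ∞) {f : RSpace n → ℂ} (hf : Measurable f)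
    (hK : BallGrowth (n - α) K fun y => ‖f y‖ₑ) (hR : ∀ᵐ x, rieszAbs α f x < ∞) {ε : ℝ}
    (hε : 0 < ε) : FracIntConverges ε P α f := by
  have hfe := hf.enorm
  obtain ⟨D, hD⟩ := exists_lintegral_rpow_mul_gaussConv_le hα hαn hA
  set F : RSpace n → ℝ≥0∞ := fun x => ENNReal.ofReal C * ∫⁻ t in Set.Ioi (0 : ℝ),
    ENNReal.ofReal (t ^ (α / 2 - 1)) * gaussConv A t (fun y => ‖f y‖ₑ) x with hF
  have hFm : Measurable F := by
    have : Measurable fun q : RSpace n × ℝ =>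
      ENNReal.ofReal (q.2 ^ (α / 2 - 1)) * gaussConv A q.2 (fun y => ‖f y‖ₑ) q.1 := by fun_prop
    exact this.lintegral_prod_right'.const_mul _
  have hGm := measurable_rpow_smul_heat hPm α hf
  have hle : ∀ x, ∫⁻ t in Set.Ioi (0 : ℝ), ‖t ^ (α / 2 - 1) • heat P t f x‖ₑ ≤ F x := by
    intro x
    simp only [hF]
    rw [← lintegral_const_mul' _ _ ENNReal.ofReal_ne_top]
    refine setLIntegral_mono' measurableSet_Ioi fun t ht => ?_
    rw [enorm_rpow_smul ht, mul_left_comm]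
    gcongr
    exact enorm_heat_le hC hG ht hf x
  set Fr : RSpace n → ℝ := fun x => ∫ t in Set.Ioi (0 : ℝ), ‖t ^ (α / 2 - 1) • heat P t f x‖
    with hFr
  have hFrm : Measurable Fr :=
    hGm.norm.stronglyMeasurable.integral_prod_right'.measurable
  have hFrle : ∀ x, ‖Fr x‖ₑ ≤ F x := fun x =>
    (enorm_integral_le_lintegral_enorm _).trans (by simpa only [enorm_norm] using hle x)
  obtain ⟨x₀, hx₀⟩ := hR.exists
  obtain ⟨Q, hQt, hQ⟩ := exists_setLIntegral_sq_rieszPotential_le hα hαn hA hKt hfe hK hx₀.ne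
  set Q' := ENNReal.ofReal C ^ 2 * Q with hQ'
  have hQ't : Q' ≠ ∞ := ENNReal.mul_ne_top (ENNReal.pow_ne_top ENNReal.ofReal_ne_top) hQt
  have hFQ : ∀ R : ℝ, 1 + ‖x₀‖ ≤ R → ∫⁻ x in Metric.ball (0 : RSpace n) R, F x ^ 2
      ≤ Q' * ENNReal.ofReal (R ^ (n : ℝ)) := fun R hR => by
    simp only [hF, mul_pow]
    rw [lintegral_const_mul' _ _ (ENNReal.pow_ne_top ENNReal.ofReal_ne_top), hQ', mul_assoc]
    gcongr
    exact hQ R hR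
  refine ⟨?_, ε / 2, by positivity, by linarith, ?_, ?_⟩
  · filter_upwards [hR] with x hx
    refine ⟨(hGm.comp (measurable_const.prodMk measurable_id)).aestronglyMeasurable, ?_⟩
    refine (hle x).trans_lt (ENNReal.mul_lt_top ENNReal.ofReal_lt_top ((hD _ hfe x).trans_lt ?_))
    exact ENNReal.mul_lt_top ENNReal.coe_lt_top hx
  · intro x
    set R := 1 + ‖x₀‖ + ‖x‖ with hRdef
    refine ⟨Metric.ball 0 R, Metric.isOpen_ball.mem_nhds ?_, hFrm.aestronglyMeasurable, ?_⟩
    · rw [mem_ball_zero_iff]; linarith [norm_nonneg x₀]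
    · calc ∫⁻ y in Metric.ball (0 : RSpace n) R, ‖Fr y‖ₑ
          ≤ ∫⁻ y in Metric.ball (0 : RSpace n) R, (1 + F y ^ 2) := by
            refine lintegral_mono fun y => (hFrle y).trans ?_
            rcases le_total (F y) 1 with h | h
            · exact h.trans le_self_add
            · exact (le_self_pow₀ h two_ne_zero).trans le_add_self
        _ = volume (Metric.ball (0 : RSpace n) R)
            + ∫⁻ y in Metric.ball (0 : RSpace n) R, F y ^ 2 := by
            rw [lintegral_add_left measurable_const]; simp
        _ < ∞ := by
            refine ENNReal.add_lt_top.2 ⟨measure_ball_lt_top, (hFQ R ?_).trans_lt ?_⟩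
            · linarith [norm_nonneg x]
            · exact ENNReal.mul_lt_top hQ't.lt_top ENNReal.ofReal_lt_top
  · change Integrable fun x => ‖Fr x‖ ^ 2 / (1 + ‖x‖) ^ ((n : ℝ) + ε / 2)
    refine ⟨Measurable.aestronglyMeasurable (by fun_prop), ?_⟩
    refine lt_of_le_of_lt ?_ (lintegral_mul_one_add_norm_rpow_lt_top (hFm.pow_const 2) hQ't
      (by linarith [norm_nonneg x₀]) hFQ (half_pos hε))
    refine lintegral_mono fun x => ?_
    have hx : 0 ≤ 1 + ‖x‖ := by positivity
    beta_reduce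
    rw [div_eq_mul_inv (‖Fr x‖ ^ 2), ← Real.rpow_neg hx, enorm_mul, enorm_pow, enorm_norm,
      Real.enorm_of_nonneg (r := _ ^ _) (by positivity)]
    gcongr
    exact hFrle x

/-- The semigroup property of the heat integrals of Morrey functions. -/
theorem ae_heat_heat (hS : IsBoundedAnalyticSemigroup S) (hP : IsHeatKernel S P) {α C A : ℝ}
    (hC : 0 < C) (hA : 0 < A)
    (hG : ∀ t : ℝ, 0 < t → ∀ x y, ‖P t x y‖ ≤ C * gaussKernel A t (x - y))
    {K : ℝ≥0∞} (hKt : K ≠ ∞) {f : RSpace n → ℂ} (hf : Measurable f)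
    (hK : BallGrowth (n - α) K fun y => ‖f y‖ₑ) {s t : ℝ} (hs : 0 < s) (ht : 0 < t) :
    ∀ᵐ x, heat P t (heat P s f) x = heat P (s + t) f x := by
  obtain ⟨θ, hθ, -, hsg, -⟩ := hS
  obtain ⟨D, hD⟩ := exists_gaussConv_le n α hA
  -- The semigroup law is known only on `L²`. Truncating both the support and the size of `f` gives
  -- `L²` functions dominated by `f`, and the identity passes to the limit by dominated convergence.
  set B : ℕ → Set (RSpace n) := fun k => {y | ‖y‖ ≤ k ∧ ‖f y‖ ≤ k} with hB
  have hBm : ∀ k, MeasurableSet (B k) := fun k =>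
    (measurableSet_le measurable_norm measurable_const).inter
      (measurableSet_le hf.norm measurable_const)
  set g : ℕ → RSpace n → ℂ := fun k => (B k).indicator f with hg
  have hgm : ∀ k, Measurable (g k) := fun k => hf.indicator (hBm k)
  have hgf : ∀ k y, ‖g k y‖ ≤ ‖f y‖ := fun k y => norm_indicator_le_norm_self _ _
  have hglim : ∀ y, Tendsto (fun k => g k y) atTop (𝓝 (f y)) := by
    intro y
    obtain ⟨k₀, hk₀⟩ := exists_nat_ge (max ‖y‖ ‖f y‖)
    refine tendsto_const_nhds.congr' ?_
    filter_upwards [eventually_ge_atTop k₀] with k hk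
    have hk' : max ‖y‖ ‖f y‖ ≤ (k : ℝ) := hk₀.trans (by exact_mod_cast hk)
    have : y ∈ B k := ⟨(le_max_left _ _).trans hk', (le_max_right _ _).trans hk'⟩
    simp only [hg, Set.indicator_of_mem this]
  have hgL : ∀ k, MemLp (g k) 2 := by
    intro k
    have hBf : volume (B k) ≠ ∞ := by
      refine ((measure_mono (t := Metric.closedBall (0 : RSpace n) k) fun y hy => ?_).trans_lt
        measure_closedBall_lt_top).ne
      rw [mem_closedBall_zero_iff]; exact hy.1
    have h1 : MemLp ((B k).indicator fun _ => (k : ℝ)) 2 (volume : Measure (RSpace n)) :=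
      memLp_indicator_const 2 (hBm k) _ (Or.inr hBf)
    refine h1.mono (hgm k).aestronglyMeasurable (ae_of_all _ fun y => ?_)
    by_cases hy : y ∈ B k
    · simpa [hg, hy] using hy.2
    · simp [hg, hy]
  have hint : ∀ {r : ℝ}, 0 < r → ∀ x, Integrable fun y => P r x y * f y := fun hr x =>
    integrable_kernel_mul hP hC hA hG hKt hf hK hr x
  have hlim : ∀ {r : ℝ}, 0 < r → ∀ x,
      Tendsto (fun k => heat P r (g k) x) atTop (𝓝 (heat P r f x)) := by
    intro r hr x
    refine tendsto_integral_of_dominated_convergence (fun y => ‖P r x y * f y‖)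
      (fun k => ((hP.measurable_right r x).mul (hgm k)).aestronglyMeasurable)
      (hint hr x).norm (fun k => ae_of_all _ fun y => ?_)
      (ae_of_all _ fun y => (hglim y).const_mul _)
    rw [norm_mul, norm_mul]
    gcongr
    exact hgf k y
  have hgc : ∀ y, gaussConv A s (fun y => ‖f y‖ₑ) y
      ≤ D * K * ENNReal.ofReal (s ^ (-(α / 2))) := fun y => hD K _ hf.enorm hK s hs y
  set E := ENNReal.ofReal C * (D * K * ENNReal.ofReal (s ^ (-(α / 2)))) with hE
  have hEt : E ≠ ∞ := ENNReal.mul_ne_top ENNReal.ofReal_ne_top (ENNReal.mul_ne_top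
    (ENNReal.mul_ne_top ENNReal.coe_ne_top hKt) ENNReal.ofReal_ne_top)
  have hgE : ∀ k y, ‖heat P s (g k) y‖ ≤ E.toReal := by
    intro k y
    rw [← toReal_enorm]
    refine ENNReal.toReal_mono hEt ((enorm_heat_le hC hG hs (hgm k) y).trans ?_)
    rw [hE]
    gcongr
    refine le_trans ?_ (hgc y)
    refine lintegral_mono fun z => ?_
    gcongr
    exact enorm_le_iff_norm_le.2 (hgf k z)
  have hlim2 : ∀ x, Tendsto (fun k => heat P t (heat P s (g k)) x) atTop
      (𝓝 (heat P t (heat P s f) x)) := by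
    intro x
    have hhm : ∀ k, Measurable (heat P s (g k)) := fun k =>
      (measurable_heat_uncurry hP.1 (hgm k)).comp (measurable_const.prodMk measurable_id)
    refine tendsto_integral_of_dominated_convergence (fun y => ‖P t x y‖ * E.toReal)
      (fun k => ((hP.measurable_right t x).mul (hhm k)).aestronglyMeasurable)
      ((integrable_kernel hP hA hG ht x).norm.mul_const _) (fun k => ae_of_all _ fun y => ?_)
      (ae_of_all _ fun y => (hlim hs y).const_mul _)
    rw [norm_mul]
    gcongr
    exact hgE k y
  have hk : ∀ k, ∀ᵐ x, heat P t (heat P s (g k)) x = heat P (s + t) (g k) x := by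
    intro k
    set u : L2Space n := (hgL k).toLp (g k) with hu
    have hug : (u : RSpace n → ℂ) =ᵐ[volume] g k := (hgL k).coeFn_toLp
    have h1 : (S (s : ℂ) u : RSpace n → ℂ) =ᵐ[volume] heat P s (g k) := by
      filter_upwards [hP.2 s hs u] with x hx
      rw [hx, ← heat_congr_ae hug]; rfl
    have hcomp : S ((s + t : ℝ) : ℂ) u = S (t : ℂ) (S (s : ℂ) u) := by
      rw [add_comm, Complex.ofReal_add, hsg _ (ofReal_mem_openSector hθ ht) _
        (ofReal_mem_openSector hθ hs)]
      rfl
    filter_upwards [hP.2 t ht (S (s : ℂ) u), hP.2 (s + t) (add_pos hs ht) u] with x h2 h3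
    rw [hcomp, h2] at h3
    rw [← heat_congr_ae h1, ← heat_congr_ae hug]
    exact h3
  filter_upwards [ae_all_iff.2 hk] with x hx
  refine tendsto_nhds_unique (hlim2 x) ?_
  simp_rw [hx]
  exact hlim (add_pos hs ht) x

/-- `(1 + |y|)^m ≤ e^{m|y|}`, and completing the square absorbs the linear exponent into the
Gaussian one. -/
theorem exists_gaussKernel_mul_rpow_le {A t m : ℝ} (hA : 0 < A) (ht : 0 < t) (hm : 0 ≤ m)
    (x : RSpace n) : ∃ E : ℝ, ∀ y, gaussKernel A t (x - y) * (1 + ‖y‖) ^ m ≤ E := by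
  refine ⟨Real.exp (m * ‖x‖ + m ^ 2 * t / (4 * A)) / t ^ ((n : ℝ) / 2), fun y => ?_⟩
  have h1 : (1 + ‖y‖) ^ m ≤ Real.exp (m * ‖y‖) := by
    rw [mul_comm, Real.exp_mul]
    gcongr
    linarith [Real.add_one_le_exp ‖y‖]
  have h2 : ‖y‖ ≤ ‖x‖ + ‖x - y‖ := by
    have := norm_sub_le x (x - y)
    rwa [sub_sub_cancel] at this
  have h3 : m * ‖x - y‖ ≤ m ^ 2 * t / (4 * A) + A * ‖x - y‖ ^ 2 / t := by
    have h4 : m ^ 2 * t / (4 * A) + A * ‖x - y‖ ^ 2 / t - m * ‖x - y‖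
        = (m * t - 2 * A * ‖x - y‖) ^ 2 / (4 * A * t) := by field_simp; ring
    have h5 : 0 ≤ (m * t - 2 * A * ‖x - y‖) ^ 2 / (4 * A * t) := by positivity
    linarith
  unfold gaussKernel
  rw [div_mul_eq_mul_div]
  gcongr
  calc _ ≤ Real.exp (-(A * ‖x - y‖ ^ 2 / t)) * Real.exp (m * ‖y‖) := by gcongr
    _ = Real.exp (-(A * ‖x - y‖ ^ 2 / t) + m * ‖y‖) := (Real.exp_add _ _).symm
    _ ≤ _ := by
        refine Real.exp_le_exp.2 ?_
        have := mul_le_mul_of_nonneg_left h2 hm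
        linarith

theorem integrable_norm_kernel_mul_of_memType (hP : IsHeatKernel S P) {C A : ℝ} (hC : 0 < C)
    (hA : 0 < A) (hG : ∀ t : ℝ, 0 < t → ∀ x y, ‖P t x y‖ ≤ C * gaussKernel A t (x - y))
    {ρ : ℝ} (hρ : 0 < ρ) {F : RSpace n → ℝ} (hF : MemType ρ F) {t : ℝ} (ht : 0 < t)
    (x : RSpace n) : Integrable fun y => ‖P t x y‖ * F y := by
  obtain ⟨E, hE⟩ := exists_gaussKernel_mul_rpow_le (m := (n : ℝ) + ρ) hA ht (by positivity) x
  refine Integrable.mono' (((integrable_gaussKernel hA ht x).const_mul C).add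
    (hF.2.const_mul (C * E)))
    ((hP.measurable_right t x).norm.aestronglyMeasurable.mul hF.1.aestronglyMeasurable)
    (ae_of_all _ fun y => ?_)
  have hg := gaussKernel_nonneg A ht (x - y)
  have hpos : 0 < (1 + ‖y‖) ^ ((n : ℝ) + ρ) := by positivity
  have h1 : gaussKernel A t (x - y) ≤ E / (1 + ‖y‖) ^ ((n : ℝ) + ρ) := by
    rw [le_div_iff₀ hpos]; exact hE y
  -- The 1 is integrated against the Gaussian, the square against the polynomial weight that
  -- dominates it.
  have h2 : ‖F y‖ ≤ 1 + ‖F y‖ ^ 2 := by nlinarith [sq_nonneg (‖F y‖ - 1), norm_nonneg (F y)]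
  rw [norm_mul, norm_norm]
  calc _ ≤ C * gaussKernel A t (x - y) * (1 + ‖F y‖ ^ 2) := by
        gcongr; exact hG t ht x y
    _ = C * gaussKernel A t (x - y) + C * (gaussKernel A t (x - y) * ‖F y‖ ^ 2) := by ring
    _ ≤ C * gaussKernel A t (x - y) + C * (E / (1 + ‖y‖) ^ ((n : ℝ) + ρ) * ‖F y‖ ^ 2) := by
        gcongr
    _ = _ := by simp only [Pi.add_apply]; ring

theorem ae_fracInt_sub_heat_fracInt (hS : IsBoundedAnalyticSemigroup S) (hP : IsHeatKernel S P)
    {α C A : ℝ} (hC : 0 < C) (hA : 0 < A)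
    (hG : ∀ t : ℝ, 0 < t → ∀ x y, ‖P t x y‖ ≤ C * gaussKernel A t (x - y))
    {K : ℝ≥0∞} (hKt : K ≠ ∞) {f : RSpace n → ℂ} (hf : Measurable f)
    (hK : BallGrowth (n - α) K fun y => ‖f y‖ₑ) {ε : ℝ} (hconv : FracIntConverges ε P α f)
    {t : ℝ} (ht : 0 < t) :
    ∀ᵐ x, fracInt P α f x - heat P t (fracInt P α f) x = fracDiff P α t f x := by
  obtain ⟨hint, ρ, hρ, -, hF⟩ := hconv
  have hGm := measurable_rpow_smul_heat hP.1 α hf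
  have hsemi : ∀ᵐ x : RSpace n, ∀ᵐ s ∂(volume.restrict (Set.Ioi (0 : ℝ))),
      heat P t (heat P s f) x = heat P (s + t) f x := by
    rw [← Measure.ae_ae_comm]
    · exact (ae_restrict_mem measurableSet_Ioi).mono fun s hs =>
        ae_heat_heat hS hP hC hA hG hKt hf hK hs ht
    · have hhm := measurable_heat_uncurry hP.1 hf
      refine measurableSet_eq_fun ?_ ?_
      · have h : StronglyMeasurable fun z : (ℝ × RSpace n) × RSpace n =>
            P t z.1.2 z.2 * heat P z.1.1 f z.2 := by
          refine Measurable.stronglyMeasurable (Measurable.mul ?_ ?_)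
          · exact hP.1.comp (measurable_const.prodMk
              ((measurable_snd.comp measurable_fst).prodMk measurable_snd))
          · exact hhm.comp ((measurable_fst.comp measurable_fst).prodMk measurable_snd)
        exact h.integral_prod_right'.measurable
      · exact hhm.comp ((measurable_fst.add_const t).prodMk measurable_snd)
  filter_upwards [hint, hsemi] with x hx hsx
  -- Absolute integrability in `(y, s)`: this requires the integral of the absolute values, and not
  -- only `L^{-α/2} f`, to be of type `ρ`.
  have hprod : Integrable (Function.uncurry fun (y : RSpace n) (s : ℝ) =>
      P t x y * (s ^ (α / 2 - 1) • heat P s f y))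
      (volume.prod (volume.restrict (Set.Ioi (0 : ℝ)))) := by
    have hm : Measurable (Function.uncurry fun (y : RSpace n) (s : ℝ) =>
        P t x y * (s ^ (α / 2 - 1) • heat P s f y)) :=
      ((hP.measurable_right t x).comp measurable_fst).mul hGm
    rw [integrable_prod_iff hm.aestronglyMeasurable]
    refine ⟨hint.mono fun y hy => Integrable.const_mul hy (P t x y), ?_⟩
    refine (integrable_norm_kernel_mul_of_memType hP hC hA hG hρ hF ht x).congr
      (ae_of_all _ fun y => ?_)
    simp only [Function.uncurry_apply_pair, norm_mul]
    rw [integral_const_mul]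
  have hswap := integral_integral_swap hprod
  have hinner : ∀ s : ℝ, ∫ y, P t x y * (s ^ (α / 2 - 1) • heat P s f y)
      = s ^ (α / 2 - 1) • heat P t (heat P s f) x := by
    intro s
    simp_rw [mul_smul_comm]
    rw [integral_smul]; rfl
  have hheat : heat P t (fracInt P α f) x = (Real.Gamma (α / 2))⁻¹ •
      ∫ s in Set.Ioi (0 : ℝ), s ^ (α / 2 - 1) • heat P (s + t) f x := by
    have h1 : heat P t (fracInt P α f) x = (Real.Gamma (α / 2))⁻¹ •
        ∫ y, ∫ s in Set.Ioi (0 : ℝ), P t x y * (s ^ (α / 2 - 1) • heat P s f y) := by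
      unfold heat fracInt
      simp_rw [mul_smul_comm]
      rw [integral_smul]
      congr 1
      refine integral_congr_ae (ae_of_all _ fun y => ?_)
      simp only [← mul_smul_comm]
      rw [integral_const_mul]; rfl
    rw [h1, hswap]
    congr 1
    refine integral_congr_ae ?_
    filter_upwards [hsx] with s hs
    rw [hinner, hs]
  have hint2 : Integrable (fun s : ℝ => s ^ (α / 2 - 1) • heat P (s + t) f x)
      (volume.restrict (Set.Ioi 0)) := by
    refine hprod.integral_prod_right.congr ?_
    filter_upwards [hsx] with s hs
    simp only [Function.uncurry_apply_pair]
    rw [hinner, hs]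
  rw [hheat, fracInt, fracDiff, ← smul_sub, ← integral_sub hx hint2]
  simp_rw [smul_sub]

theorem memScriptM_fracInt (hPm : Measurable fun q : ℝ × RSpace n × RSpace n => P q.1 q.2.1 q.2.2)
    {α : ℝ} {f : RSpace n → ℂ} (hf : Measurable f) {ε : ℝ} (hconv : FracIntConverges ε P α f) :
    MemScriptM ε (fracInt P α f) := by
  obtain ⟨-, ρ, hρ, hρε, hF⟩ := hconv
  set c := |(Real.Gamma (α / 2))⁻¹| with hc
  have hm : Measurable (fracInt P α f) := by
    have := (measurable_rpow_smul_heat hPm α hf).stronglyMeasurable.integral_prod_right'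
      (ν := volume.restrict (Set.Ioi (0 : ℝ)))
    exact this.measurable.const_smul (Real.Gamma (α / 2))⁻¹
  have hle : ∀ x, ‖fracInt P α f x‖
      ≤ c * ‖∫ t in Set.Ioi (0 : ℝ), ‖t ^ (α / 2 - 1) • heat P t f x‖‖ := by
    intro x
    rw [fracInt, norm_smul, Real.norm_eq_abs, ← hc]
    gcongr
    exact (norm_integral_le_integral_norm _).trans (le_abs_self _)
  refine ⟨ρ, hρ, hρε, ?_, ?_⟩
  · refine (hF.1.smul c).mono hm.aestronglyMeasurable (ae_of_all _ fun x => ?_)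
    refine (hle x).trans (le_of_eq ?_)
    rw [Pi.smul_apply, norm_smul, Real.norm_of_nonneg (abs_nonneg _)]
  · refine (hF.2.const_mul (c ^ 2)).mono' (Measurable.aestronglyMeasurable (by fun_prop))
      (ae_of_all _ fun x => ?_)
    rw [Real.norm_of_nonneg (by positivity), ← mul_div_assoc, ← mul_pow]
    gcongr
    exact hle x

theorem enorm_fracDiff_le (α t : ℝ) (f : RSpace n → ℂ) (x : RSpace n) :
    ‖fracDiff P α t f x‖ₑ ≤ ‖(Real.Gamma (α / 2))⁻¹‖ₑ * ∫⁻ s in Set.Ioi (0 : ℝ),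
      ENNReal.ofReal (s ^ (α / 2 - 1)) * ‖heat P s f x - heat P (s + t) f x‖ₑ := by
  rw [fracDiff, enorm_smul]
  gcongr
  refine (enorm_integral_le_lintegral_enorm _).trans (le_of_eq ?_)
  exact setLIntegral_congr_fun measurableSet_Ioi fun s hs => enorm_rpow_smul hs _ _

/-- The mean oscillation estimate for the difference operator. -/
theorem exists_setLAverage_fracDiff_le (hS : IsBoundedAnalyticSemigroup S)
    (hP : IsHeatKernel S P) {α C A : ℝ} (hα : 0 < α) (hC : 0 < C) (hA : 0 < A)
    (hG : ∀ t : ℝ, 0 < t → ∀ x y, ‖P t x y‖ ≤ C * gaussKernel A t (x - y)) :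
    ∃ D : ℝ≥0, ∀ (K : ℝ≥0∞) (f : RSpace n → ℂ), K ≠ ∞ → Measurable f →
      BallGrowth (n - α) K (fun y => ‖f y‖ₑ) → ∀ (c : RSpace n) (r : ℝ), 0 < r →
      ⨍⁻ x in Metric.ball c r, ‖fracDiff P α (r ^ 2) f x‖ₑ ∂volume ≤ D * K := by
  obtain ⟨D, hD⟩ := exists_setLIntegral_heat_sub_le hS hP hα hC hA hG
  set ω := volume (Metric.ball (0 : RSpace n) 1) with hω
  have hω0 : ω ≠ 0 := (Metric.measure_ball_pos _ _ one_pos).ne'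
  have hωt : ω ≠ ∞ := measure_ball_lt_top.ne
  set γ := ‖(Real.Gamma (α / 2))⁻¹‖ₑ with hγ
  have hγt : γ ≠ ∞ := enorm_ne_top
  have hCt : γ * D * 2 / ω ≠ ∞ := ENNReal.div_ne_top
    (ENNReal.mul_ne_top (ENNReal.mul_ne_top hγt ENNReal.coe_ne_top) (by norm_num)) hω0
  refine ⟨(γ * D * 2 / ω).toNNReal, fun K f hKt hf hK c r hr => ?_⟩
  have hr2 : 0 < r ^ 2 := by positivity
  have hrn : ENNReal.ofReal (r ^ (n : ℝ)) ≠ 0 := by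
    rw [Ne, ENNReal.ofReal_eq_zero, not_le]; positivity
  have hpow : ENNReal.ofReal (r ^ ((n : ℝ) - α)) * ENNReal.ofReal ((r ^ 2) ^ (α / 2))
      = ENNReal.ofReal (r ^ (n : ℝ)) := by
    rw [← ENNReal.ofReal_mul (by positivity), ← Real.rpow_natCast r 2, ← Real.rpow_mul hr.le,
      ← Real.rpow_add hr]
    congr 2; push_cast; ring
  rw [setLAverage_eq, ENNReal.coe_toNNReal hCt, volume_ball_eq c hr, ← hω]
  refine ENNReal.div_le_of_le_mul ?_
  calc _ ≤ ∫⁻ x in Metric.ball c r, γ * ∫⁻ s in Set.Ioi (0 : ℝ),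
        ENNReal.ofReal (s ^ (α / 2 - 1)) * ‖heat P s f x - heat P (s + r ^ 2) f x‖ₑ :=
        lintegral_mono fun x => enorm_fracDiff_le α _ f x
    _ ≤ γ * (D * K * (ENNReal.ofReal (r ^ (n : ℝ)) + ENNReal.ofReal (r ^ (n : ℝ)))) := by
        rw [lintegral_const_mul' _ _ hγt]
        gcongr
        refine (hD K f hKt hf hK (r ^ 2) r hr2 hr c).trans (le_of_eq ?_)
        rw [hpow]
    _ = γ * D * 2 * K * ENNReal.ofReal (r ^ (n : ℝ)) := by ring
    _ = (γ * D * 2 / ω * ω) * K * ENNReal.ofReal (r ^ (n : ℝ)) := by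
        rw [ENNReal.div_mul_cancel hω0 hωt]
    _ = _ := by ring

theorem integrableOn_fracDiff (hS : IsBoundedAnalyticSemigroup S)
    (hP : IsHeatKernel S P) {α C A : ℝ} (hα : 0 < α) (hC : 0 < C) (hA : 0 < A)
    (hG : ∀ t : ℝ, 0 < t → ∀ x y, ‖P t x y‖ ≤ C * gaussKernel A t (x - y))
    {K : ℝ≥0∞} (hKt : K ≠ ∞) {f : RSpace n → ℂ} (hf : Measurable f)
    (hK : BallGrowth (n - α) K fun y => ‖f y‖ₑ) {t : ℝ} (ht : 0 < t) :
    ∀ᵐ x, IntegrableOn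
      (fun r : ℝ => r ^ (α / 2 - 1) • (heat P r f x - heat P (r + t) f x)) (Set.Ioi 0) := by
  filter_upwards [ae_lintegral_heat_sub_lt_top hS hP hα hC hA hG hKt hf hK ht] with x hx
  have hhm := measurable_heat_uncurry hP.1 hf
  refine ⟨Measurable.aestronglyMeasurable 
    (Measurable.smul (measurable_id.pow_const _) (Measurable.sub ?_ ?_)), ?_⟩
  · exact hhm.comp (measurable_id.prodMk measurable_const)
  · exact hhm.comp ((measurable_id.add_const t).prodMk measurable_const)
  · refine lt_of_eq_of_lt ?_ hx
    exact setLIntegral_congr_fun measurableSet_Ioi fun s hs => enorm_rpow_smul hs _ _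

/-- The identity at time `r²` may fail on a null set depending on `r`; averages over a ball do not
see it, so the supremum over balls is still bounded at every point. -/
theorem bmoNorm_le_of_ae_eq {g : RSpace n → ℂ} {G : ℝ → RSpace n → ℂ} {Q : ℝ≥0∞}
    (hg : ∀ t : ℝ, 0 < t → ∀ᵐ x, g x - heat P t g x = G t x)
    (hG : ∀ (c : RSpace n) (r : ℝ), 0 < r →
      ⨍⁻ x in Metric.ball c r, ‖G (r ^ 2) x‖ₑ ∂volume ≤ Q) : bmoNorm P g ≤ Q := by
  refine essSup_le_of_ae_le Q (ae_of_all _ fun x => ?_)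
  refine iSup_le fun c => iSup_le fun r => iSup_le fun hr => iSup_le fun _ => ?_
  refine le_trans (le_of_eq ?_) (hG c r hr)
  refine setLAverage_congr_fun_ae measurableSet_ball ?_
  filter_upwards [hg (r ^ 2) (by positivity)] with y hy _
  rw [hy]

end FractionalIntegral

/-! ### The main theorem. -/

theorem GaussianBound.exists_norm_le_gaussKernel {n : ℕ} {P : ℝ → RSpace n → RSpace n → ℂ}
    (hG : GaussianBound P) : ∃ C A : ℝ, 0 < C ∧ 0 < A ∧
      ∀ t : ℝ, 0 < t → ∀ x y, ‖P t x y‖ ≤ C * gaussKernel A t (x - y) := by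
  obtain ⟨C, A, hC, hA, h⟩ := hG
  refine ⟨C, A, hC, hA, fun t ht x y => (h t ht x y).trans (le_of_eq ?_)⟩
  unfold gaussKernel; ring

theorem theorem3p1 (n : ℕ) (α p lam : ℝ) (hα : 0 < α) (hαn : α < n)
    (hp : 1 ≤ p) (hpn : p < n / α) (hlam : lam = n - α * p)
    (L : L2Space n →ₗ.[ℂ] L2Space n) (S : ℂ → L2Space n →L[ℂ] L2Space n)
    (P : ℝ → RSpace n → RSpace n → ℂ)
    (hS : IsBoundedAnalyticSemigroup S) (hL : IsSemigroupGenerator L S)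
    (hP : IsHeatKernel S P) (hG : GaussianBound P) :
    ∃ C : ℝ≥0, 0 < C ∧ ∀ f : RSpace n → ℂ, MemMorrey p lam f →
      -- the semigroup and the difference operators are defined on all of the Morrey space
      (∀ t : ℝ, 0 < t → ∀ x : RSpace n, Integrable fun y => P t x y * f y) ∧
      (∀ t : ℝ, 0 < t → ∀ᵐ x : RSpace n, IntegrableOn
        (fun r : ℝ => r ^ (α / 2 - 1) • (heat P r f x - heat P (r + t) f x)) (Set.Ioi 0)) ∧
      -- the oscillation estimate, for every `f` in the Morrey space
      (∀ (c : RSpace n) (r : ℝ), 0 < r →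
        ⨍⁻ x in Metric.ball c r, ‖fracDiff P α (r ^ 2) f x‖ₑ ∂volume ≤ C * morreyNorm p lam f) ∧
      -- the bound in `BMO_L`, whenever the integral defining `L^{-α/2} f` converges
      (∀ ε : ℝ, 0 < ε → FracIntConverges ε P α f →
        (∀ t : ℝ, 0 < t → ∀ᵐ x : RSpace n,
          fracInt P α f x - heat P t (fracInt P α f) x = fracDiff P α t f x) ∧
        MemBMO ε P (fracInt P α f) ∧
        bmoNorm P (fracInt P α f) ≤ C * morreyNorm p lam f) ∧
      -- it converges whenever the Riesz potential of `|f|` is finite almost everywhere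
      ((∀ᵐ x : RSpace n, rieszAbs α f x < ∞) → ∀ ε : ℝ, 0 < ε → FracIntConverges ε P α f) := by
  obtain ⟨C, A, hC, hA, hG'⟩ := hG.exists_norm_le_gaussKernel
  have hn : 0 < n := by exact_mod_cast hα.trans hαn
  obtain ⟨W, hW⟩ := exists_ballGrowth_of_morreyNorm hn hαn hp hlam
  obtain ⟨D, hD⟩ := exists_setLAverage_fracDiff_le hS hP hα hC hA hG'
  -- The summand 1 only ensures that the constant is positive.
  refine ⟨D * W + 1, by positivity, fun f₀ hf₀ => ?_⟩
  -- All the operators depend only on the class of `f₀` modulo null sets, so a Borel representative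
  -- may be used.
  obtain ⟨f, hf, hff⟩ : ∃ f : RSpace n → ℂ, Measurable f ∧ f₀ =ᵐ[volume] f :=
    ⟨_, hf₀.1.aestronglyMeasurable.stronglyMeasurable_mk.measurable,
      hf₀.1.aestronglyMeasurable.ae_eq_mk⟩
  have hheat : ∀ t, heat P t f₀ = heat P t f := heat_congr_ae hff
  have hfrac : fracInt P α f₀ = fracInt P α f := by
    unfold fracInt; simp_rw [hheat]
  have hdiff : ∀ t, fracDiff P α t f₀ = fracDiff P α t f := fun t => by
    unfold fracDiff; simp_rw [hheat]
  have hconv : ∀ ε, FracIntConverges ε P α f₀ ↔ FracIntConverges ε P α f := fun ε => by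
    unfold FracIntConverges; simp_rw [hheat]
  have hriesz : ∀ x, rieszAbs α f₀ x = rieszAbs α f x := fun x =>
    lintegral_congr_ae (hff.mono fun y hy => by simp only [hy])
  set K : ℝ≥0∞ := W * morreyNorm p lam f₀ with hKdef
  have hKt : K ≠ ∞ := ENNReal.mul_ne_top ENNReal.coe_ne_top hf₀.2.ne
  have hK : BallGrowth (n - α) K fun y => ‖f y‖ₑ := fun c r hr => by
    refine le_trans (le_of_eq ?_) (hW f₀ hf₀.1.aestronglyMeasurable c r hr)
    exact lintegral_congr_ae (ae_restrict_of_ae (hff.mono fun y hy => by simp only [hy]))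
  have hosc : ∀ (c : RSpace n) (r : ℝ), 0 < r →
      ⨍⁻ x in Metric.ball c r, ‖fracDiff P α (r ^ 2) f x‖ₑ ∂volume
        ≤ ((D * W + 1 : ℝ≥0) : ℝ≥0∞) * morreyNorm p lam f₀ := fun c r hr => by
    refine (hD K f hKt hf hK c r hr).trans ?_
    rw [hKdef, ← mul_assoc]
    push_cast
    gcongr
    exact le_self_add
  simp_rw [hheat, hdiff, hfrac, hconv, hriesz]
  refine ⟨fun t ht x => ?_, fun t ht => integrableOn_fracDiff hS hP hα hC hA hG' hKt hf hK ht,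
    hosc, fun ε _ hc => ?_,
    fun hR ε hε => fracIntConverges_of_rieszAbs hP.1 hα hαn hC hA hG' hKt hf hK hR hε⟩
  · refine (integrable_kernel_mul hP hC hA hG' hKt hf hK ht x).congr ?_
    exact hff.mono fun y hy => by simp only [hy]
  · have hsub : ∀ t : ℝ, 0 < t → ∀ᵐ x,
        fracInt P α f x - heat P t (fracInt P α f) x = fracDiff P α t f x := fun t ht =>
      ae_fracInt_sub_heat_fracInt hS hP hC hA hG' hKt hf hK hc ht
    have hbmo := bmoNorm_le_of_ae_eq hsub hosc
    exact ⟨hsub, ⟨memScriptM_fracInt hP.1 hf hc,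
      hbmo.trans_lt (ENNReal.mul_lt_top ENNReal.coe_lt_top hf₀.2)⟩, hbmo⟩
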